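/- Let $T \ge 0$, $\alpha\in(1,2)$ and $\gamma = 3-\alpha$. Let $\mathcal D=\mathcal D([0,T],[0,1])$ be the space of càdlàg paths $[0,T]\to[0,1]$ with the Skorokhod topology, and let $\mathcal M(\mathcal D)$ be the space of Borel probability measures on $\mathcal D$ with the weak topology. For a càdlàg path $\eta=(\eta_t)_{0\le t\le T}$ with values in the symmetric group $\mathcal S_N$, $N \ge 1$ (where $\eta_t(i)$ is the position at time $t$ of the particle with label $i$), let \[ \mu^{\eta}=\frac1N\sum_{i=1}^N\delta_{X^{\eta}(i)}\in\mathcal M(\mathcal D),\qquad X^{\eta}(i)=\Bigl(\tfrac1N\eta_t(i)\Bigr)_{0\le t\le T}, \] be the empirical measure of its rescaled trajectories. A permuton process is a $\pi\in\mathcal M(\mathcal D)$ under which almost every path is continuous and whose marginal at each time $t\in[0,T]$ is the uniform distribution on $[0,1]$. Let $\mathcal P\subseteq\mathcal M(\mathcal D)$ be the set consisting of all permuton processes and of all measures $\mu^{\eta}$, for $N\ge1$ and $\eta$ a càdlàg path in $\mathcal S_N$. For each $N\ge1$ let $\eta^N=(\eta^N_t)_{0\le t\le T}$ be, under $\mathbb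 P^N$, the interchange process on $\{1,\dots,N\}$ speeded up by $N^\alpha$, that is, the càdlàg Markov process on $\mathcal S_N$, with an arbitrary initial distribution, whose generator is \[ (\mathcal L f)(\eta)=\tfrac12N^{\alpha}\sum_{x=1}^{N-1}\bigl(f(\eta^{x,x+1})-f(\eta)\bigr), \] where $\eta^{x,x+1}$ is $\eta$ with the particles at positions $x$ and $x+1$ swapped. Then the family of random measures $\mu^{\eta^N}$ is exponentially tight in $\mathcal P$ at speed $N^\gamma$: there are compact sets $K_m\subseteq\mathcal P$, $m = 0, 1, 2, \dots$, such that for every $m$ \[ \limsup_{N\to\infty}N^{-\gamma}\log\mathbb P^N\bigl(\mu^{\eta^N}\notin K_m\bigr)\le -m , \] with the convention $\log 0=-\infty$. -/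

import Mathlib

open MeasureTheory Filter Topology
open scoped ENNReal

noncomputable section

/-! ### Càdlàg paths and the Skorokhod topology -/

/-- A function on `[0, T]` is càdlàg if it is right-continuous and has left limits. -/
def IsCadlag {T : ℝ} {E : Type*} [TopologicalSpace E] (f : Set.Icc (0 : ℝ) T → E) : Prop :=
  ∀ t, ContinuousWithinAt f (Set.Ici t) t ∧ ∃ l, Tendsto f (𝓝[<] t) (𝓝 l)

theorem IsCadlag.comp {T : ℝ} {E F : Type*} [TopologicalSpace E] [TopologicalSpace F]
    {f : Set.Icc (0 : ℝ) T → E} (hf : IsCadlag f) {g : E → F} (hg : Continuous g) :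
    IsCadlag (fun t => g (f t)) := fun t =>
  ⟨hg.continuousAt.comp_continuousWithinAt (hf t).1,
    let ⟨l, hl⟩ := (hf t).2
    ⟨g l, (hg.tendsto l).comp hl⟩⟩

/-- The space `𝒟([0, T], E)` of càdlàg paths from `[0, T]` to `E`. -/
@[ext]
structure CadlagPath (T : ℝ) (E : Type*) [TopologicalSpace E] where
  toFun : Set.Icc (0 : ℝ) T → E
  isCadlag : IsCadlag toFun

instance CadlagPath.instCoeFun {T : ℝ} {E : Type*} [TopologicalSpace E] :
    CoeFun (CadlagPath T E) (fun _ => Set.Icc (0 : ℝ) T → E) := ⟨CadlagPath.toFun⟩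

/-- The Skorokhod (J1) distance between two paths: the infimum, over all increasing bijections
`φ` of `[0, T]` onto itself, of `max (sup_t |φ t - t|) (sup_t d(f t, g (φ t)))`. -/
def skorokhodEDist {T : ℝ} {E : Type*} [PseudoEMetricSpace E] (f g : CadlagPath T E) : ℝ≥0∞ :=
  ⨅ φ : Set.Icc (0 : ℝ) T ≃o Set.Icc (0 : ℝ) T,
    max (⨆ t, edist (φ t) t) (⨆ t, edist (f t) (g (φ t)))

/-- The space of càdlàg paths carries the Skorokhod distance and hence the Skorokhod topology. -/
instance CadlagPath.instPseudoEMetricSpace {T : ℝ} {E : Type*} [PseudoEMetricSpace E] :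
    PseudoEMetricSpace (CadlagPath T E) where
  edist := skorokhodEDist
  edist_self f := by
    refine le_antisymm ((iInf_le _ (OrderIso.refl _)).trans ?_) bot_le
    simp
  edist_comm f g := by
    have key : ∀ f g : CadlagPath T E, skorokhodEDist f g ≤ skorokhodEDist g f := by
      intro f g
      refine le_iInf fun φ => (iInf_le _ φ.symm).trans (max_le_max ?_ ?_)
      · refine iSup_le fun t => ?_
        have h := le_iSup (fun t => edist (φ t) t) (φ.symm t)
        simpa [edist_comm] using h
      · refine iSup_le fun t => ?_
        have h := le_iSup (fun t => edist (g t) (f (φ t))) (φ.symm t)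
        simpa [edist_comm] using h
    exact le_antisymm (key f g) (key g f)
  edist_triangle f g h := by
    simp only [skorokhodEDist]
    refine ENNReal.le_iInf_add_iInf fun φ ψ => (iInf_le _ (φ.trans ψ)).trans (max_le ?_ ?_)
    · refine iSup_le fun t => ?_
      calc edist (ψ (φ t)) t ≤ edist (φ t) t + edist (ψ (φ t)) (φ t) := by
            rw [add_comm]; exact edist_triangle _ _ _
        _ ≤ _ := add_le_add
            ((le_iSup (fun t => edist (φ t) t) t).trans (le_max_left _ _))
            ((le_iSup (fun t => edist (ψ t) t) (φ t)).trans (le_max_left _ _))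
    · refine iSup_le fun t => ?_
      calc edist (f t) (h (ψ (φ t)))
          ≤ edist (f t) (g (φ t)) + edist (g (φ t)) (h (ψ (φ t))) := edist_triangle _ _ _
        _ ≤ _ := add_le_add
            ((le_iSup (fun t => edist (f t) (g (φ t))) t).trans (le_max_right _ _))
            ((le_iSup (fun t => edist (g t) (h (ψ t))) (φ t)).trans (le_max_right _ _))

/-- The path space carries the Borel σ-algebra of the Skorokhod topology. -/
instance CadlagPath.instMeasurableSpace {T : ℝ} {E : Type*} [PseudoEMetricSpace E] :
    MeasurableSpace (CadlagPath T E) := borel _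

instance CadlagPath.instBorelSpace {T : ℝ} {E : Type*} [PseudoEMetricSpace E] :
    BorelSpace (CadlagPath T E) := ⟨rfl⟩

/-! ### Permutation-valued paths, permuton processes and the space `𝒫` -/

/-- Càdlàg paths `η : [0, T] → S_N`, where the finite set `S_N` is discrete.
`η t i` is the position at time `t` of the particle with label `i`; labels and positions are
numbered `0, …, N - 1`. -/
structure PermPath (T : ℝ) (N : ℕ) where
  toFun : Set.Icc (0 : ℝ) T → Equiv.Perm (Fin N)
  isCadlag : @IsCadlag T (Equiv.Perm (Fin N)) ⊥ toFun

instance PermPath.instCoeFun {T : ℝ} {N : ℕ} :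
    CoeFun (PermPath T N) (fun _ => Set.Icc (0 : ℝ) T → Equiv.Perm (Fin N)) := ⟨PermPath.toFun⟩

/-- The rescaled position in `{1/N, 2/N, …, 1}` of the site `x`; the sites are numbered from `0`,
so the site `x : Fin N` is the `(x + 1)`-st one. -/
def sitePos {N : ℕ} (x : Fin N) : unitInterval :=
  ⟨((x : ℝ) + 1) / N, by positivity,
    div_le_one_of_le₀ (by exact_mod_cast x.isLt) (by positivity)⟩

/-- The rescaled trajectory `X^η(i) = η(i) / N` of the particle `i`. -/
def PermPath.trajectory {T : ℝ} {N : ℕ} (η : PermPath T N) (i : Fin N) : CadlagPath T unitInterval where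
  toFun t := sitePos (η t i)
  isCadlag :=
    letI : TopologicalSpace (Equiv.Perm (Fin N)) := ⊥
    IsCadlag.comp η.isCadlag (g := fun σ => sitePos (σ i)) continuous_bot

/-- The empirical distribution `μ^η = (1 / N) ∑ᵢ δ_{X^η(i)}` of the trajectories. -/
def PermPath.empirical {T : ℝ} {N : ℕ} [NeZero N] (η : PermPath T N) :
    ProbabilityMeasure (CadlagPath T unitInterval) :=
  ⟨(N : ℝ≥0∞)⁻¹ • ∑ i : Fin N, Measure.dirac (η.trajectory i), ⟨by
    simp [ENNReal.inv_mul_cancel, NeZero.ne N]⟩⟩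

/-- A permuton process (identified with its law): almost all paths are continuous and the
marginal at every time is uniform on `[0, 1]`. -/
def IsPermutonProcess {T : ℝ} (π : ProbabilityMeasure (CadlagPath T unitInterval)) : Prop :=
  (∀ᵐ γ ∂(π : Measure (CadlagPath T unitInterval)), Continuous γ.toFun) ∧
    ∀ t, (π : Measure (CadlagPath T unitInterval)).map (fun γ => γ.toFun t) = volume

/-- The space `𝒫` of all permuton processes and all approximate permuton processes, the latter
being the empirical distributions of càdlàg permutation-valued paths. It is a subspace of the
space of Borel probability measures on `𝒟([0, T], [0, 1])` with the weak topology. -/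
def permutonSpace (T : ℝ) : Set (ProbabilityMeasure (CadlagPath T unitInterval)) :=
  {π | IsPermutonProcess π} ∪
    {π | ∃ (N : ℕ+) (η : PermPath T N), π = η.empirical}

/-! ### The interchange process -/

/-- `η^{x,x+1}`: the configuration `σ` with the particles at the neighbouring positions `x` and
`x + 1` swapped. Here `x` runs through the `N - 1` edges of the interval. -/
def swapAt {N : ℕ} (x : Fin (N - 1)) (σ : Equiv.Perm (Fin N)) : Equiv.Perm (Fin N) :=
  Equiv.swap ⟨x, by omega⟩ ⟨x + 1, by omega⟩ * σ

/-- The generator `(ℒ f)(σ) = (1/2) N^α ∑ₓ (f(σ^{x,x+1}) - f(σ))`. -/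
def interchangeGenerator (α : ℝ) (N : ℕ) (f : Equiv.Perm (Fin N) → ℝ)
    (σ : Equiv.Perm (Fin N)) : ℝ :=
  1 / 2 * (N : ℝ) ^ α * ∑ x : Fin (N - 1), (f (swapAt x σ) - f σ)

/-- The generator as a matrix of jump rates (`Q`-matrix): its `(σ, τ)` entry is
`(ℒ 1_{τ})(σ)`. -/
def interchangeRates (α : ℝ) (N : ℕ) : Matrix (Equiv.Perm (Fin N)) (Equiv.Perm (Fin N)) ℝ :=
  Matrix.of fun σ τ => interchangeGenerator α N (Pi.single τ 1) σ

/-- The transition probabilities `(e^{tℒ})(σ, τ)`. -/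
def interchangeKernel (α : ℝ) (N : ℕ) (t : ℝ) :
    Matrix (Equiv.Perm (Fin N)) (Equiv.Perm (Fin N)) ℝ :=
  NormedSpace.exp (t • interchangeRates α N)

/-- `η` is, under the probability measure `P`, an interchange process on `N` particles: a
càdlàg Markov process on `[0, T]` with generator `ℒ` (and an arbitrary initial distribution).
The law is given through its finite-dimensional distributions. -/
def IsInterchangeProcess {Ω : Type*} [MeasurableSpace Ω] (P : Measure Ω) (T α : ℝ) (N : ℕ)
    (η : Ω → PermPath T N) : Prop :=
  (∀ (t : Set.Icc (0 : ℝ) T) (σ : Equiv.Perm (Fin N)), MeasurableSet {ω | η ω t = σ}) ∧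
  ∀ (n : ℕ) (t : Fin (n + 1) → Set.Icc (0 : ℝ) T) (σ : Fin (n + 1) → Equiv.Perm (Fin N)),
    Monotone t →
    P.real {ω | ∀ j, η ω (t j) = σ j} =
      P.real {ω | η ω (t 0) = σ 0} *
        ∏ j : Fin n, interchangeKernel α N ((t j.succ : ℝ) - (t j.castSucc : ℝ))
          (σ j.castSucc) (σ j.succ)

end

/-! A compact subset of `permutonSpace` has to control two things: the oscillations of most
particles, uniformly in `N`, and, for each single `N`, the spacing of the jumps, because families of
step paths are compact in the Skorokhod topology once their jump times stay apart.

Oscillations. Suppose that at least `ε N` particles travel `ε N / 3` sites from the beginning of one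
of `M` windows of length `T / M`. Recording for every particle whether this happens, in which window
and in which direction gives `(2M + 1) ^ N` patterns, which is `e^{O(N)}` and negligible at speed `N
^ γ` since `γ > 1`. For a fixed pattern, every listed particle is watched in its window until it has
covered the distance, so that the total watched displacement reaches `ε² N² / 3`. Its exponential
moment with parameter `l = c N ^ (1 - α)` is bounded through the generator. The first order terms
telescope along the interval and cost only `T l N ^ α = O(N)`. The second order terms act on each
particle during one window only and cost `2 l² N ^ α T N / M`, that is `(2 c² T / M) N ^ γ`. The
gain is `(c ε² / 3) N ^ γ`, so a large `c` and then a large `M` give any prescribed rate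
(`IsInterchangeProcess.measure_modulus_le`, `exists_modulus_bound`).

Jumps. For fixed `N` every path has a positive gap between its jumps, hence some deterministic gap
`g N` works up to probability `e^{-m N ^ γ} / 2` (`exists_measure_not_isGapped_le`).

The set `K m` is the closure of the empirical measures with both controls (`controlledEmpirical`).
It is compact by Arzelà–Ascoli and Prokhorov. A limit point is either a limit of measures with one
fixed `N`, and then is itself empirical, or a limit with `N → ∞`, and then is a permuton process:
Borel–Cantelli makes its paths continuous, and permutations have nearly uniform marginals
(`closure_controlledEmpirical_subset`). -/

noncomputable section

/-! ### Skorokhod topology: closed sets, evaluations, separation, Arzelà–Ascoli. -/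

section SkorokhodTopology

variable {T : ℝ}

theorem CadlagPath.exists_timeChange_of_edist_lt {E : Type*} [PseudoEMetricSpace E]
    {f g : CadlagPath T E} {r : ℝ≥0∞} (h : edist f g < r) :
    ∃ φ : Set.Icc (0 : ℝ) T ≃o Set.Icc (0 : ℝ) T,
      (∀ t, edist (φ t) t < r) ∧ ∀ t, edist (f t) (g (φ t)) < r := by
  change skorokhodEDist f g < r at h
  obtain ⟨φ, hφ⟩ := iInf_lt_iff.1 h
  exact ⟨φ, fun t => (le_iSup (fun t => edist (φ t) t) t).trans_lt ((le_max_left _ _).trans_lt hφ),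
    fun t => (le_iSup (fun t => edist (f t) (g (φ t))) t).trans_lt ((le_max_right _ _).trans_lt hφ)⟩

theorem CadlagPath.edist_le_of_timeChange {E : Type*} [PseudoEMetricSpace E]
    {f g : CadlagPath T E} {r : ℝ≥0∞} (φ : Set.Icc (0 : ℝ) T ≃o Set.Icc (0 : ℝ) T)
    (h₁ : ∀ t, edist (φ t) t ≤ r) (h₂ : ∀ t, edist (f t) (g (φ t)) ≤ r) : edist f g ≤ r :=
  (iInf_le _ φ).trans (max_le (iSup_le h₁) (iSup_le h₂))

theorem CadlagPath.edist_le_of_forall_edist_le {E : Type*} [PseudoEMetricSpace E]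
    {f g : CadlagPath T E} {r : ℝ≥0∞} (h : ∀ t, edist (f t) (g t) ≤ r) : edist f g ≤ r :=
  CadlagPath.edist_le_of_timeChange (OrderIso.refl _) (by simp) h

variable {E : Type*} [PseudoMetricSpace E]

/-- Metric form of Skorokhod closeness, for use along the neighbourhood filter. -/
theorem CadlagPath.eventually_exists_timeChange (f : CadlagPath T E) {r : ℝ} (hr : 0 < r) :
    ∀ᶠ g in 𝓝 f, ∃ φ : Set.Icc (0 : ℝ) T ≃o Set.Icc (0 : ℝ) T,
      (∀ t, dist (φ t) t < r) ∧ ∀ t, dist (f t) (g (φ t)) < r := by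
  have hr' : 0 < ENNReal.ofReal r := ENNReal.ofReal_pos.2 hr
  filter_upwards [Metric.eball_mem_nhds f hr'] with g hg
  rw [Metric.mem_eball, edist_comm] at hg
  obtain ⟨φ, h₁, h₂⟩ := CadlagPath.exists_timeChange_of_edist_lt hg
  refine ⟨φ, fun t => ?_, fun t => ?_⟩
  · simpa [edist_dist, ENNReal.ofReal_lt_ofReal_iff hr] using h₁ t
  · simpa [edist_dist, ENNReal.ofReal_lt_ofReal_iff hr] using h₂ t

/-- The paths with modulus of continuity at most `ε` at scale `δ`. -/
def modulusSet (T : ℝ) (E : Type*) [PseudoMetricSpace E] (δ ε : ℝ) : Set (CadlagPath T E) :=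
  {f | ∀ s t, dist s t < δ → dist (f s) (f t) ≤ ε}

/-- The strict inequality `dist s t < δ` leaves slack: a time change moving each time by less than
half of `δ - dist s t` keeps the two times within `δ`. -/
theorem isClosed_modulusSet (δ ε : ℝ) : IsClosed (modulusSet T E δ ε) := by
  refine isClosed_of_closure_subset fun f hf s t hst => ?_
  refine le_of_forall_pos_le_add fun r hr => ?_
  have hr' : 0 < min (r / 2) ((δ - dist s t) / 2) := by
    refine lt_min (by positivity) (by linarith)
  obtain ⟨g, hg, φ, h₁, h₂⟩ := ((mem_closure_iff_frequently.1 hf).and_eventually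
    (f.eventually_exists_timeChange hr')).exists
  have h1s := (h₁ s).trans_le (min_le_right _ _)
  have h1t := (h₁ t).trans_le (min_le_right _ _)
  have h2s := (h₂ s).trans_le (min_le_left _ _)
  have h2t := (h₂ t).trans_le (min_le_left _ _)
  have hφ : dist (φ s) (φ t) < δ := by
    have := dist_triangle4 (φ s) s t (φ t)
    rw [dist_comm t] at this
    linarith
  have := dist_triangle4 (f s) (g (φ s)) (g (φ t)) (f t)
  have := hg _ _ hφ
  rw [dist_comm (f t)] at h2t
  linarith

/-- Closeness to a continuous `g` means uniform closeness to the continuous function `g ∘ φ`, and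
uniform limits of continuous functions are continuous. -/
theorem isClosed_setOf_continuous : IsClosed {f : CadlagPath T E | Continuous f.toFun} := by
  refine isClosed_of_closure_subset fun f hf => ?_
  refine continuous_of_uniform_approx_of_continuous fun u hu => ?_
  obtain ⟨r, hr, hru⟩ := Metric.mem_uniformity_dist.1 hu
  obtain ⟨g, hg, φ, h₁, h₂⟩ := ((mem_closure_iff_frequently.1 hf).and_eventually
    (f.eventually_exists_timeChange hr)).exists
  exact ⟨fun t => g (φ t), Continuous.comp (g := g.toFun) hg φ.continuous, fun t => hru (h₂ t)⟩

/-- Evaluation at an interior time is not continuous on the whole path space; continuity at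
continuous paths is what the identification of the marginals of a limit needs. -/
theorem CadlagPath.continuousAt_eval {f : CadlagPath T E} (hf : Continuous f.toFun)
    (t : Set.Icc (0 : ℝ) T) : ContinuousAt (fun g : CadlagPath T E => g t) f := by
  refine Metric.tendsto_nhds.2 fun r hr => ?_
  obtain ⟨d, hd, hfd⟩ := Metric.continuous_iff.1 hf t (r / 2) (by positivity)
  filter_upwards [f.eventually_exists_timeChange (lt_min hd (half_pos hr))] with g ⟨φ, h₁, h₂⟩
  have h₁' := (h₁ (φ.symm t)).trans_le (min_le_left _ _)
  have h₂' := (h₂ (φ.symm t)).trans_le (min_le_right _ _)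
  rw [φ.apply_symm_apply] at h₁' h₂'
  have h3 : dist (f (φ.symm t)) (f t) < r / 2 := hfd (φ.symm t) (by rwa [dist_comm])
  have := dist_triangle_left (g t) (f t) (f (φ.symm t))
  linarith

theorem isCadlag_of_continuous {F : Type*} [TopologicalSpace F] {f : Set.Icc (0 : ℝ) T → F}
    (hf : Continuous f) : IsCadlag f := fun t =>
  ⟨hf.continuousWithinAt, f t, hf.continuousAt.tendsto.mono_left nhdsWithin_le_nhds⟩

/-- To the right of `t` the values of `f` are approximated by values of `g` at times still to the
right of `t`, so right-continuity gives equality. The last time has nothing to its right, but every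
time change fixes it. -/
theorem CadlagPath.eq_of_edist_eq_zero {F : Type*} [MetricSpace F] {f g : CadlagPath T F}
    (h : edist f g = 0) : f = g := by
  have happrox : ∀ r : ℝ, 0 < r → ∀ t, ∃ s, dist s t < r ∧ dist (f t) (g s) < r := by
    intro r hr t
    obtain ⟨φ, h₁, h₂⟩ := CadlagPath.exists_timeChange_of_edist_lt
      (h.trans_lt (ENNReal.ofReal_pos.2 hr))
    refine ⟨φ t, ?_, ?_⟩
    · simpa [edist_dist, ENNReal.ofReal_lt_ofReal_iff hr] using h₁ t
    · simpa [edist_dist, ENNReal.ofReal_lt_ofReal_iff hr] using h₂ t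
  have htop : ∀ t : Set.Icc (0 : ℝ) T, (∀ s, s ≤ t) → f t = g t := by
    intro t ht
    refine eq_of_forall_dist_le fun r hr => ?_
    obtain ⟨φ, -, h₂⟩ := CadlagPath.exists_timeChange_of_edist_lt
      (h.trans_lt (ENNReal.ofReal_pos.2 hr))
    have hφ : φ t = t := le_antisymm (ht _) (by
      have := φ.monotone (ht (φ.symm t)); rwa [φ.apply_symm_apply] at this)
    have := h₂ t
    rw [hφ, edist_dist, ENNReal.ofReal_lt_ofReal_iff hr] at this
    exact this.le
  ext t
  by_cases ht : ∀ s, s ≤ t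
  · exact htop t ht
  push Not at ht
  obtain ⟨b, hb⟩ := ht
  have hne : (𝓝[>] t).NeBot := by
    have : (Set.Ioo t b) ⊆ Set.Ioi t := fun x hx => hx.1
    have htb : (t : ℝ) < b := hb
    rw [mem_closure_iff_nhdsWithin_neBot.symm]
    rw [Metric.mem_closure_iff]
    intro r hr
    refine ⟨⟨t + min (r / 2) (b - t), ?_, ?_⟩, ?_, ?_⟩
    · exact add_nonneg t.2.1 (le_min (by positivity) (by linarith))
    · linarith [min_le_right (r / 2) ((b : ℝ) - t), b.2.2]
    · change (t : ℝ) < t + _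
      have : 0 < min (r / 2) ((b : ℝ) - t) := lt_min (by positivity) (by linarith)
      linarith
    · have h0 : 0 ≤ min (r / 2) ((b : ℝ) - t) := le_min (by positivity) (by linarith)
      rw [Subtype.dist_eq, Real.dist_eq]
      simp only [sub_add_cancel_left, abs_neg, abs_of_nonneg h0]
      linarith [min_le_left (r / 2) ((b : ℝ) - t)]
  have hf := (f.isCadlag t).1.mono Set.Ioi_subset_Ici_self
  refine tendsto_nhds_unique hf.tendsto (Metric.tendsto_nhds.2 fun r hr => ?_)
  have hg := Metric.tendsto_nhds.1 (g.isCadlag t).1.tendsto (r / 2) (by positivity)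
  rw [eventually_iff, mem_nhdsWithin] at hg
  obtain ⟨U, hU, htU, hUg⟩ := hg
  filter_upwards [mem_nhdsWithin_of_mem_nhds (hU.mem_nhds htU), self_mem_nhdsWithin] with u huU hut
  obtain ⟨d, hd, hdU⟩ := Metric.isOpen_iff.1 (hU.inter isOpen_Ioi) u ⟨huU, hut⟩
  obtain ⟨s, hs₁, hs₂⟩ := happrox (min d (r / 2)) (lt_min hd (by positivity)) u
  have hs := hdU (Metric.mem_ball.2 (hs₁.trans_le (min_le_left _ _)))
  have h1 : dist (g s) (g t) < r / 2 := hUg ⟨hs.1, (Set.mem_Ioi.1 hs.2).le⟩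
  have := dist_triangle (f u) (g s) (g t)
  have := hs₂.trans_le (min_le_right _ _)
  change dist (f u) (g t) < r
  linarith

instance CadlagPath.instT2Space {F : Type*} [MetricSpace F] : T2Space (CadlagPath T F) := by
  have : T0Space (CadlagPath T F) := ⟨fun f g h =>
    CadlagPath.eq_of_edist_eq_zero (EMetric.inseparable_iff.1 h)⟩
  infer_instance

/-- Arzelà–Ascoli along an ultrafilter of càdlàg paths. -/
theorem CadlagPath.exists_ultrafilter_le_nhds [CompactSpace E] {ι : Type*} {p : ι → Prop} {δ ε : ι → ℝ}
    (hδ : ∀ j, 0 < δ j) (hε : ∀ r > 0, ∃ j, p j ∧ ε j < r) (U : Ultrafilter (CadlagPath T E))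
    (hU : ∀ j, p j → modulusSet T E (δ j) (ε j) ∈ U) :
    ∃ f : CadlagPath T E, (∀ j, p j → f ∈ modulusSet T E (δ j) (ε j)) ∧ (U : Filter _) ≤ 𝓝 f := by
  have hlim : ∀ t : Set.Icc (0 : ℝ) T, ∃ x, Tendsto (fun f : CadlagPath T E => f t) U (𝓝 x) := by
    intro t
    obtain ⟨x, -, hx⟩ := isCompact_univ.ultrafilter_le_nhds' (U.map fun f => f t) univ_mem
    exact ⟨x, hx⟩
  choose x hx using hlim
  have hmod : ∀ j, p j → ∀ s t, dist s t < δ j → dist (x s) (x t) ≤ ε j := by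
    intro j hj s t hst
    refine le_of_tendsto ((hx s).dist (hx t)) ?_
    filter_upwards [hU j hj] with f hf using hf s t hst
  have hcont : Continuous x := by
    refine Metric.continuous_iff.2 fun t r hr => ?_
    obtain ⟨j, hj, hjr⟩ := hε r hr
    exact ⟨δ j, hδ j, fun s hs => (hmod j hj s t hs).trans_lt hjr⟩
  refine ⟨⟨x, isCadlag_of_continuous hcont⟩, fun j hj => hmod j hj, ?_⟩
  refine Metric.nhds_basis_closedEBall.ge_iff.2 fun r hr => ?_
  obtain ⟨q, hq, hqr⟩ : ∃ q : ℝ, 0 < q ∧ ENNReal.ofReal q ≤ r := by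
    rcases eq_or_ne r ⊤ with rfl | hr'
    · exact ⟨1, one_pos, le_top⟩
    · exact ⟨r.toReal, ENNReal.toReal_pos hr.ne' hr', ENNReal.ofReal_toReal_le⟩
  -- Pointwise convergence on a finite `δ j`-net and the common modulus at scale `δ j` give uniform
  -- closeness, with one third of `q` for each of three distances.
  obtain ⟨j, hj, hjq⟩ := hε (q / 3) (by positivity)
  obtain ⟨A, -, hAfin, hA⟩ := Metric.finite_approx_of_totallyBounded
    (isCompact_univ (X := Set.Icc (0 : ℝ) T)).totallyBounded (δ j) (hδ j)
  have hfin : ∀ᶠ f : CadlagPath T E in (U : Filter _), ∀ a ∈ A, dist (f a) (x a) < q / 3 :=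
    (hAfin.eventually_all).2 fun a _ => Metric.tendsto_nhds.1 (hx a) _ (by positivity)
  filter_upwards [hfin, hU j hj] with f hf hfm
  refine (CadlagPath.edist_le_of_forall_edist_le fun t => ?_).trans hqr
  obtain ⟨a, ha, hta⟩ := Set.mem_iUnion₂.1 (hA (Set.mem_univ t))
  rw [Metric.mem_ball] at hta
  rw [edist_dist]
  refine ENNReal.ofReal_le_ofReal ?_
  have h1 := dist_triangle4 (f t) (f a) (x a) (x t)
  have h2 := hfm t a hta
  have h3 := hmod j hj a t (by rwa [dist_comm])
  have h4 := hf a ha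
  change dist (f t) (x t) ≤ q
  linarith

end SkorokhodTopology

/-! ### Step paths with separated jump times. -/

section StepPaths

variable {T : ℝ}

/-- The finite families of times in `(0, T]` which are `δ`-separated, and which have distance at
least `δ` from `0` and, unless they are equal to `T`, from `T`. -/
def gappedTimes (T δ : ℝ) (k : ℕ) : Set (Fin k → Set.Icc (0 : ℝ) T) :=
  {t | (∀ i j, i ≠ j → δ ≤ dist (t i) (t j)) ∧ (∀ i, δ ≤ (t i : ℝ)) ∧
    ∀ i, (t i : ℝ) ≤ T - δ ∨ (t i : ℝ) = T}

/-- The condition at `T` is a disjunction because time changes fix `T`: a jump time tending to `T`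
from below does not produce a jump at `T` in the limit. Each alternative is closed. -/
theorem isCompact_gappedTimes (T δ : ℝ) (k : ℕ) : IsCompact (gappedTimes T δ k) := by
  refine IsClosed.isCompact ?_
  have hc : ∀ i : Fin k, Continuous fun t : Fin k → Set.Icc (0 : ℝ) T => (t i : ℝ) := fun i =>
    continuous_subtype_val.comp (continuous_apply i)
  refine IsClosed.and ?_ (IsClosed.and ?_ ?_)
  · simp only [Set.ofPred_forall]
    refine isClosed_iInter fun i => isClosed_iInter fun j => isClosed_iInter fun _ =>
      isClosed_le continuous_const ((continuous_apply i).dist (continuous_apply j))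
  · simp only [Set.ofPred_forall]
    exact isClosed_iInter fun i => isClosed_le continuous_const (hc i)
  · simp only [Set.ofPred_forall, Set.ofPred_or]
    exact isClosed_iInter fun i => (isClosed_le (hc i) continuous_const).union
      (isClosed_eq (hc i) continuous_const)

/-- A Lipschitz perturbation of the identity, fixing the endpoints, is a time change. -/
theorem exists_timeChange_of_lipschitz {p : ℝ → ℝ} {L : NNReal} (hL : L < 1)
    (hp : LipschitzWith L p) (h0 : p 0 = 0) (hT : p T = 0) :
    ∃ φ : Set.Icc (0 : ℝ) T ≃o Set.Icc (0 : ℝ) T, ∀ u, (φ u : ℝ) = u + p u := by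
  have hmono : StrictMono fun x => x + p x := by
    intro x y hxy
    have h1 := hp.dist_le_mul x y
    rw [Real.dist_eq, Real.dist_eq, abs_sub_comm x y, abs_of_pos (sub_pos.2 hxy)] at h1
    have h2 := le_abs_self (p x - p y)
    have h3 : (L : ℝ) * (y - x) < 1 * (y - x) :=
      mul_lt_mul_of_pos_right (by exact_mod_cast hL) (sub_pos.2 hxy)
    change x + p x < y + p y
    linarith
  have hcont : Continuous fun x => x + p x := continuous_id.add hp.continuous
  have hmaps : ∀ u : Set.Icc (0 : ℝ) T, (u : ℝ) + p u ∈ Set.Icc 0 T := fun u =>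
    ⟨by simpa [h0] using hmono.monotone u.2.1, by simpa [hT] using hmono.monotone u.2.2⟩
  let φ : Set.Icc (0 : ℝ) T → Set.Icc (0 : ℝ) T := fun u => ⟨u + p u, hmaps u⟩
  have hφ : StrictMono φ := fun u v huv => hmono huv
  have hsurj : Function.Surjective φ := by
    intro v
    have hTT : (0 : ℝ) ≤ T := v.2.1.trans v.2.2
    obtain ⟨u, hu, huv⟩ := intermediate_value_Icc hTT hcont.continuousOn
      (show (v : ℝ) ∈ Set.Icc (0 + p 0) (T + p T) by rw [h0, hT]; simp)
    exact ⟨⟨u, hu⟩, Subtype.ext huv⟩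
  exact ⟨hφ.orderIsoOfSurjective φ hsurj, fun u => rfl⟩

/-- The required displacement is `s i - t i` at `t i` and `0` at the endpoints. As these points are
`δ` apart, it is Lipschitz there with constant `2 r / δ ≤ 1 / 2`, and a Lipschitz extension to the
line gives the time change. -/
theorem exists_timeChange_of_gappedTimes {δ r : ℝ} (hδ : 0 < δ) (hr : 4 * r ≤ δ) {k : ℕ}
    {t s : Fin k → Set.Icc (0 : ℝ) T} (ht : t ∈ gappedTimes T δ k) (hs : s ∈ gappedTimes T δ k)
    (hts : ∀ i, dist (t i) (s i) ≤ r) (hr0 : 0 ≤ r) :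
    ∃ φ : Set.Icc (0 : ℝ) T ≃o Set.Icc (0 : ℝ) T,
      (∀ i, φ (t i) = s i) ∧ ∀ u, dist (φ u) u ≤ 2 * r / δ * T := by
  classical
  obtain ⟨hsep, hlow, hupp⟩ := ht
  have hinj : ∀ i j, (t i : ℝ) = t j → i = j := by
    intro i j hij
    by_contra hne
    have := hsep i j hne
    rw [Subtype.dist_eq, hij, dist_self] at this
    linarith
  let f : ℝ → ℝ := fun x => if h : ∃ i, (t i : ℝ) = x then (s h.choose : ℝ) - t h.choose else 0
  have hft : ∀ i, f (t i) = s i - t i := by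
    intro i
    have h : ∃ j, (t j : ℝ) = t i := ⟨i, rfl⟩
    have hi : h.choose = i := hinj _ _ h.choose_spec
    simp only [f, dif_pos h, hi]
  have hf0 : f 0 = 0 := by
    have h : ¬ ∃ j, (t j : ℝ) = 0 := by
      rintro ⟨j, hj⟩
      linarith [hlow j]
    simp only [f, dif_neg h]
  have hfT : f T = 0 := by
    -- If `t j = T`, then `s j` is within `r < δ` of `T`, so the gap condition forces `s j = T` as
    -- well.
    by_cases h : ∃ j, (t j : ℝ) = T
    · obtain ⟨j, hj⟩ := h
      rw [← hj, hft j]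
      have h1 := hts j
      rw [Subtype.dist_eq, Real.dist_eq, hj] at h1
      have h2 := le_abs_self (T - (s j : ℝ))
      rcases hs.2.2 j with h3 | h3
      · linarith
      · rw [h3, hj, sub_self]
    · simp only [f, dif_neg h]
  have hfabs : ∀ i, |f (t i)| ≤ r := by
    intro i
    rw [hft, abs_sub_comm]
    simpa [Subtype.dist_eq, Real.dist_eq] using hts i
  have hL0 : 0 ≤ 2 * r / δ := by positivity
  set L : NNReal := ⟨2 * r / δ, hL0⟩ with hL
  have hLδ : (L : ℝ) * δ = 2 * r := by
    change 2 * r / δ * δ = _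
    field_simp
  have key : ∀ x y : ℝ, |f x| ≤ r → |f y| ≤ r → δ ≤ |x - y| → |f x - f y| ≤ L * |x - y| := by
    intro x y hx hy hxy
    have h1 : (L : ℝ) * δ ≤ L * |x - y| := mul_le_mul_of_nonneg_left hxy hL0
    have h2 := abs_sub (f x) (f y)
    linarith
  have hendt : ∀ x : ℝ, (x = 0 ∨ x = T) → ∀ i, |f x - f (t i)| ≤ L * |x - t i| := by
    rintro x (rfl | rfl) i
    · refine key _ _ (by rw [hf0, abs_zero]; exact hr0) (hfabs i) ?_
      rw [zero_sub, abs_neg]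
      exact (hlow i).trans (le_abs_self _)
    · rcases hupp i with h | h
      · refine key _ _ (by rw [hfT, abs_zero]; exact hr0) (hfabs i) ?_
        exact le_trans (by linarith) (le_abs_self _)
      · rw [h]; simp
  have hlip : LipschitzOnWith L f ({0, T} ∪ Set.range fun i => (t i : ℝ)) := by
    refine LipschitzOnWith.of_dist_le_mul fun x hx y hy => ?_
    rw [Real.dist_eq, Real.dist_eq]
    rcases hx with hx | ⟨i, rfl⟩ <;> rcases hy with hy | ⟨j, rfl⟩
    · have hz : ∀ z ∈ ({0, T} : Set ℝ), f z = 0 := by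
        rintro z (rfl | rfl)
        exacts [hf0, hfT]
      rw [hz x hx, hz y hy, sub_self, abs_zero]
      positivity
    · exact hendt x hx j
    · rw [abs_sub_comm, abs_sub_comm (t i : ℝ)]
      exact hendt y hy i
    · by_cases hij : i = j
      · simp [hij]
      · exact key _ _ (hfabs i) (hfabs j) (hsep i j hij)
  obtain ⟨p, hp, hpf⟩ := hlip.extend_real
  have hp0 : p 0 = 0 := (hpf (by simp)).symm.trans hf0
  have hpT : p T = 0 := (hpf (by simp)).symm.trans hfT
  obtain ⟨φ, hφ⟩ := exists_timeChange_of_lipschitz (T := T) (L := L) (by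
    rw [← NNReal.coe_lt_coe]
    change 2 * r / δ < 1
    rw [div_lt_one hδ]
    linarith) hp hp0 hpT
  refine ⟨φ, fun i => Subtype.ext ?_, fun u => ?_⟩
  · rw [hφ, ← hpf (Or.inr ⟨i, rfl⟩), hft]
    ring
  · rw [Subtype.dist_eq, Real.dist_eq, hφ, add_sub_cancel_left]
    have := hp.dist_le_mul u 0
    rw [Real.dist_eq, Real.dist_eq, hp0, sub_zero, sub_zero, abs_of_nonneg u.2.1] at this
    exact this.trans (mul_le_mul_of_nonneg_left u.2.2 hL0)

/-- The number of the times `t i` up to time `u`. -/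
def stepIndex {k : ℕ} (t : Fin k → Set.Icc (0 : ℝ) T) (u : Set.Icc (0 : ℝ) T) : Fin (k + 1) :=
  ⟨(Finset.univ.filter fun i => t i ≤ u).card,
    Nat.lt_succ_of_le ((Finset.card_filter_le _ _).trans (by simp))⟩

theorem stepIndex_eq {k : ℕ} {t s : Fin k → Set.Icc (0 : ℝ) T} {u v : Set.Icc (0 : ℝ) T}
    (h : ∀ i, t i ≤ u ↔ s i ≤ v) : stepIndex t u = stepIndex s v := by
  simp only [stepIndex, h]

theorem isCadlag_step {F : Type*} [TopologicalSpace F] {k : ℕ} (t : Fin k → Set.Icc (0 : ℝ) T)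
    (σ : Fin (k + 1) → F) : IsCadlag fun u => σ (stepIndex t u) := by
  intro u
  constructor
  · refine ContinuousWithinAt.congr_of_eventuallyEq (f := fun _ => σ (stepIndex t u))
      continuousWithinAt_const ?_ rfl
    have : ∀ᶠ v in 𝓝[≥] u, ∀ i, (t i ≤ v ↔ t i ≤ u) := by
      refine eventually_all.2 fun i => ?_
      rcases le_or_gt (t i) u with h | h
      · filter_upwards [self_mem_nhdsWithin] with v hv
        exact iff_of_true (h.trans hv) h
      · filter_upwards [mem_nhdsWithin_of_mem_nhds (Iio_mem_nhds h)] with v hv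
        exact iff_of_false (not_le.2 hv) (not_le.2 h)
    filter_upwards [this] with v hv
    rw [stepIndex_eq hv]
  · refine ⟨σ ⟨(Finset.univ.filter fun i => t i < u).card,
      Nat.lt_succ_of_le ((Finset.card_filter_le _ _).trans (by simp))⟩, ?_⟩
    refine tendsto_const_nhds.congr' ?_
    have : ∀ᶠ v in 𝓝[<] u, ∀ i, (t i ≤ v ↔ t i < u) := by
      refine eventually_all.2 fun i => ?_
      rcases lt_or_ge (t i) u with h | h
      · filter_upwards [mem_nhdsWithin_of_mem_nhds (Ioi_mem_nhds h)] with v hv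
        exact iff_of_true (le_of_lt hv) h
      · filter_upwards [self_mem_nhdsWithin] with v hv
        exact iff_of_false (not_le.2 (lt_of_lt_of_le hv h)) (not_lt.2 h)
    filter_upwards [this] with v hv
    simp only [stepIndex, hv]

/-- The path that takes the value `σ j` when `j` of the times `t i` have passed. -/
def stepPath {F : Type*} [TopologicalSpace F] {k : ℕ} (σ : Fin (k + 1) → F)
    (t : Fin k → Set.Icc (0 : ℝ) T) : CadlagPath T F :=
  ⟨fun u => σ (stepIndex t u), isCadlag_step t σ⟩

/-- A time change carrying the jump times of one path to those of the other makes the two step paths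
coincide, so only the size of the time change counts. -/
theorem continuousOn_stepPath {E : Type*} [PseudoEMetricSpace E] {k : ℕ} {δ : ℝ} (hδ : 0 < δ)
    (σ : Fin (k + 1) → E) : ContinuousOn (stepPath (T := T) σ) (gappedTimes T δ k) := by
  intro t ht
  refine EMetric.tendsto_nhds.2 fun ε hε => ?_
  have hlim : Tendsto (fun s : Fin k → Set.Icc (0 : ℝ) T =>
      ENNReal.ofReal (2 * dist s t / δ * T)) (𝓝 t) (𝓝 0) := by
    have : Continuous fun s : Fin k → Set.Icc (0 : ℝ) T =>
      ENNReal.ofReal (2 * dist s t / δ * T) :=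
      ENNReal.continuous_ofReal.comp (by fun_prop)
    simpa using this.tendsto t
  filter_upwards [self_mem_nhdsWithin, mem_nhdsWithin_of_mem_nhds (hlim.eventually_lt_const hε),
    mem_nhdsWithin_of_mem_nhds (Metric.ball_mem_nhds t (show 0 < δ / 4 by positivity))]
    with s hs hsε hsδ
  refine lt_of_le_of_lt ?_ hsε
  rw [Metric.mem_ball] at hsδ
  obtain ⟨φ, h₁, h₂⟩ := exists_timeChange_of_gappedTimes hδ (r := dist s t) (by linarith) hs ht
    (fun i => dist_le_pi_dist s t i) dist_nonneg
  refine CadlagPath.edist_le_of_timeChange φ (fun u => ?_) fun u => ?_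
  · rw [edist_dist]
    exact ENNReal.ofReal_le_ofReal (h₂ u)
  · have : stepIndex s u = stepIndex t (φ u) := stepIndex_eq fun i => by
      rw [← h₁ i, φ.le_iff_le]
    simp [stepPath, this]

end StepPaths

/-! ### Càdlàg permutation paths as step paths with a positive gap. -/

section GappedPaths

variable {T : ℝ} {S : Type*}

/-- A function for which any two jumps are at distance at least `δ`, without jumps in `(0, δ)`
and in `(T - δ, T)`. -/
structure IsGapped (δ : ℝ) (f : Set.Icc (0 : ℝ) T → S) : Prop where
  window : ∀ s t u : Set.Icc (0 : ℝ) T, s < t → t < u → (u : ℝ) - s < δ → f s = f t ∨ f t = f u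
  left : ∀ s u : Set.Icc (0 : ℝ) T, s < u → (u : ℝ) < δ → f s = f u
  right : ∀ s u : Set.Icc (0 : ℝ) T, s < u → T - δ < s → (u : ℝ) < T → f s = f u

theorem IsGapped.anti {δ δ' : ℝ} {f : Set.Icc (0 : ℝ) T → S} (hf : IsGapped δ f) (h : δ' ≤ δ) :
    IsGapped δ' f where
  window s t u hst htu hsu := hf.window s t u hst htu (hsu.trans_le h)
  left s u hsu hu := hf.left s u hsu (hu.trans_le h)
  right s u hsu hs hu := hf.right s u hsu (by linarith) hu

theorem PermPath.eventually_eq_right {N : ℕ} (η : PermPath T N) (t : Set.Icc (0 : ℝ) T) :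
    ∀ᶠ v in 𝓝[≥] t, η v = η t := by
  let _ : TopologicalSpace (Equiv.Perm (Fin N)) := ⊥
  have : DiscreteTopology (Equiv.Perm (Fin N)) := ⟨rfl⟩
  have := (η.isCadlag t).1.tendsto
  rw [nhds_discrete] at this
  exact this (Set.mem_singleton _)

theorem PermPath.exists_eventually_eq_left {N : ℕ} (η : PermPath T N) (t : Set.Icc (0 : ℝ) T) :
    ∃ l, ∀ᶠ v in 𝓝[<] t, η v = l := by
  let _ : TopologicalSpace (Equiv.Perm (Fin N)) := ⊥
  have : DiscreteTopology (Equiv.Perm (Fin N)) := ⟨rfl⟩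
  obtain ⟨l, hl⟩ := (η.isCadlag t).2
  rw [nhds_discrete] at hl
  exact ⟨l, hl (Set.mem_singleton _)⟩

/-- Around every time `c` the path has one value before `c` and one from `c` on. A Lebesgue number
of this cover puts every short window into one such neighbourhood; the neighbourhoods of `0` and `T`
give the endpoint conditions. -/
theorem PermPath.exists_isGapped {N : ℕ} (η : PermPath T N) (hT : 0 ≤ T) :
    ∃ δ > 0, IsGapped δ η.toFun := by
  have hloc : ∀ c : Set.Icc (0 : ℝ) T, ∃ d > 0, ∀ x y, dist x c < d → dist y c < d →
      (x < c ↔ y < c) → η x = η y := by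
    intro c
    obtain ⟨l, hl⟩ := η.exists_eventually_eq_left c
    have h2 := η.eventually_eq_right c
    rw [eventually_nhdsWithin_iff] at hl h2
    obtain ⟨d, hd, h⟩ := Metric.eventually_nhds_iff.1 (hl.and h2)
    refine ⟨d, hd, fun x y hx hy hxy => ?_⟩
    by_cases hxc : x < c
    · rw [(h hx).1 hxc, (h hy).1 (hxy.1 hxc)]
    · rw [(h hx).2 (not_lt.1 hxc), (h hy).2 (not_lt.1 fun h => hxc (hxy.2 h))]
  choose d hd hdη using hloc
  obtain ⟨δ, hδ, hleb⟩ := lebesgue_number_lemma_of_metric (c := fun c => Metric.ball c (d c))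
    (isCompact_univ (X := Set.Icc (0 : ℝ) T)) (fun c => Metric.isOpen_ball)
    (fun c _ => Set.mem_iUnion.2 ⟨c, Metric.mem_ball_self (hd c)⟩)
  let z : Set.Icc (0 : ℝ) T := ⟨0, le_rfl, hT⟩
  let e : Set.Icc (0 : ℝ) T := ⟨T, hT, le_rfl⟩
  refine ⟨min δ (min (d z) (d e)), lt_min hδ (lt_min (hd z) (hd e)), ?_, ?_, ?_⟩
  · intro s t u hst htu hsu
    obtain ⟨c, hc⟩ := hleb s (Set.mem_univ s)
    have hst' : (s : ℝ) < t := hst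
    have htu' : (t : ℝ) < u := htu
    have hδ' := min_le_left δ (min (d z) (d e))
    have hs : dist s c < d c := hc (Metric.mem_ball_self hδ)
    have ht : dist t c < d c := hc (by
      rw [Metric.mem_ball, Subtype.dist_eq, Real.dist_eq, abs_of_pos] <;> linarith)
    have hu : dist u c < d c := hc (by
      rw [Metric.mem_ball, Subtype.dist_eq, Real.dist_eq, abs_of_pos] <;> linarith)
    by_cases htc : t < c
    · exact Or.inl (hdη c s t hs ht (iff_of_true (hst.trans htc) htc))
    · exact Or.inr (hdη c t u ht hu (iff_of_false htc fun h => htc (htu.trans h)))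
  · intro s u hsu hu
    have hu' : (u : ℝ) < d z := hu.trans_le ((min_le_right _ _).trans (min_le_left _ _))
    have hsu' : (s : ℝ) < u := hsu
    have hz : ∀ x : Set.Icc (0 : ℝ) T, dist x z = x := fun x => by
      rw [Subtype.dist_eq, Real.dist_eq]
      change |(x : ℝ) - 0| = x
      rw [sub_zero, abs_of_nonneg x.2.1]
    exact hdη z s u (by rw [hz]; linarith) (by rw [hz]; exact hu')
      (iff_of_false (not_lt.2 s.2.1) (not_lt.2 u.2.1))
  · intro s u hsu hs hu
    have hs' : T - d e < s :=
      (sub_le_sub_left ((min_le_right δ _).trans (min_le_right (d z) _)) T).trans_lt hs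
    have hsu' : (s : ℝ) < u := hsu
    refine hdη e s u ?_ ?_ (iff_of_true (show (s : ℝ) < T by linarith) hu) <;>
      rw [Subtype.dist_eq, Real.dist_eq, abs_sub_comm, abs_of_nonneg] <;> linarith

variable {f : Set.Icc (0 : ℝ) T → S}

/-- The times at which a function has a jump, that is, is not left-continuous. -/
def jumpTimes (f : Set.Icc (0 : ℝ) T → S) : Set (Set.Icc (0 : ℝ) T) :=
  {u | ∃ᶠ v in 𝓝[<] u, f v ≠ f u}

theorem IsGapped.le_sub_of_mem_jumpTimes {δ : ℝ} (hf : IsGapped δ f) {u v : Set.Icc (0 : ℝ) T}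
    (hu : u ∈ jumpTimes f) (hv : v ∈ jumpTimes f) (huv : u < v) : δ ≤ (v : ℝ) - u := by
  by_contra! h
  have h1 : ∀ᶠ s : Set.Icc (0 : ℝ) T in 𝓝[<] u, (v : ℝ) - s < δ := by
    have : Continuous fun s : Set.Icc (0 : ℝ) T => (v : ℝ) - s := by fun_prop
    exact mem_nhdsWithin_of_mem_nhds ((this.tendsto u).eventually_lt_const h)
  obtain ⟨s, hs, hsδ, hsu⟩ := (hu.and_eventually (h1.and self_mem_nhdsWithin)).exists
  have h2 : ∀ᶠ t in 𝓝[<] v, u < t := mem_nhdsWithin_of_mem_nhds (Ioi_mem_nhds huv)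
  obtain ⟨t, ht, htu, htv⟩ := (hv.and_eventually (h2.and self_mem_nhdsWithin)).exists
  have hsu : s < u := hsu
  have htv : t < v := htv
  have htv' : (t : ℝ) < v := htv
  have h2 := (hf.window s t v (hsu.trans htu) htv hsδ).resolve_right ht
  have h3 := (hf.window s u t hsu htu (by linarith)).resolve_left hs
  exact hs (h2.trans h3.symm)

theorem IsGapped.le_of_mem_jumpTimes {δ : ℝ} (hf : IsGapped δ f) {u : Set.Icc (0 : ℝ) T}
    (hu : u ∈ jumpTimes f) : δ ≤ u := by
  by_contra! h
  obtain ⟨s, hs, hsu⟩ := (hu.and_eventually self_mem_nhdsWithin).exists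
  exact hs (hf.left s u hsu h)

theorem IsGapped.le_or_eq_of_mem_jumpTimes {δ : ℝ} (hf : IsGapped δ f) {u : Set.Icc (0 : ℝ) T}
    (hu : u ∈ jumpTimes f) : (u : ℝ) ≤ T - δ ∨ (u : ℝ) = T := by
  by_contra! h
  have h1 : ∀ᶠ s : Set.Icc (0 : ℝ) T in 𝓝[<] u, T - δ < s :=
    mem_nhdsWithin_of_mem_nhds
      ((continuous_subtype_val.tendsto u).eventually_const_lt h.1)
  obtain ⟨s, hs, hsδ, hsu⟩ := (hu.and_eventually (h1.and self_mem_nhdsWithin)).exists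
  exact hs (hf.right s u hsu hsδ (lt_of_le_of_ne u.2.2 h.2))

theorem IsGapped.floor_injOn {δ : ℝ} (hδ : 0 < δ) (hf : IsGapped δ f) :
    Set.InjOn (fun u : Set.Icc (0 : ℝ) T => ⌊(u : ℝ) / δ⌋₊) (jumpTimes f) := by
  intro u hu v hv huv
  have hlt : ∀ u v : Set.Icc (0 : ℝ) T, u ∈ jumpTimes f → v ∈ jumpTimes f → u < v →
      ⌊(u : ℝ) / δ⌋₊ ≠ ⌊(v : ℝ) / δ⌋₊ := by
    intro u v hu hv huv h
    have h1 := hf.le_sub_of_mem_jumpTimes hu hv huv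
    have h2 := Nat.floor_le (div_nonneg u.2.1 hδ.le)
    have h3 := Nat.lt_floor_add_one ((v : ℝ) / δ)
    rw [← h] at h3
    have h4 : (v : ℝ) / δ - u / δ < 1 := by linarith
    rw [← sub_div, div_lt_one hδ] at h4
    linarith
  rcases lt_trichotomy u v with h | h | h
  · exact (hlt u v hu hv h huv).elim
  · exact h
  · exact (hlt v u hv hu h huv.symm).elim

theorem IsGapped.finite_jumpTimes {δ : ℝ} (hδ : 0 < δ) (hf : IsGapped δ f) :
    (jumpTimes f).Finite ∧ (jumpTimes f).ncard ≤ ⌊T / δ⌋₊ + 1 := by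
  have hmaps : Set.MapsTo (fun u : Set.Icc (0 : ℝ) T => ⌊(u : ℝ) / δ⌋₊) (jumpTimes f)
      (Finset.range (⌊T / δ⌋₊ + 1) : Finset ℕ) := by
    intro u _
    simp only [Finset.coe_range, Set.mem_Iio, Nat.lt_succ_iff]
    exact Nat.floor_le_floor (div_le_div_of_nonneg_right u.2.2 hδ.le)
  refine ⟨Set.Finite.of_injOn hmaps (hf.floor_injOn hδ) (Finset.finite_toSet _), ?_⟩
  have := Set.ncard_le_ncard_of_injOn _ hmaps (hf.floor_injOn hδ) (Finset.finite_toSet _)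
  simpa [Set.ncard_coe_finset] using this

/-- A right-continuous function is constant between its jumps. -/
theorem eq_of_forall_notMem_jumpTimes (hr : ∀ t, ∀ᶠ v in 𝓝[≥] t, f v = f t)
    {u v : Set.Icc (0 : ℝ) T} (huv : u ≤ v) (h : ∀ w, u < w → w ≤ v → w ∉ jumpTimes f) :
    f u = f v := by
  let _ : TopologicalSpace S := ⊥
  have : DiscreteTopology S := ⟨rfl⟩
  have : Inhabited (Set.Icc (0 : ℝ) T) := ⟨u⟩
  have hcont : ContinuousOn f (Set.Icc u v) := by
    intro w hw
    rw [ContinuousWithinAt, nhds_discrete, tendsto_pure]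
    rcases hw.1.eq_or_lt with rfl | huw
    · exact nhdsWithin_mono _ (fun x hx => hx.1) (hr u)
    · have h1 := h w huw hw.2
      rw [jumpTimes, Set.mem_ofPred_eq, not_frequently] at h1
      refine mem_nhdsWithin_of_mem_nhds ?_
      have h2 : ∀ᶠ x in 𝓝[<] w ⊔ 𝓝[≥] w, f x = f w :=
        eventually_sup.2 ⟨h1.mono fun x hx => not_not.1 hx, hr w⟩
      rwa [nhdsLT_sup_nhdsGE] at h2
  exact (isPreconnected_Icc (a := u) (b := v)).constant hcont ⟨le_rfl, huv⟩ ⟨huv, le_rfl⟩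

theorem IsGapped.exists_eq_step [Nonempty S] {δ : ℝ} (hδ : 0 < δ) (hf : IsGapped δ f)
    (hr : ∀ t, ∀ᶠ v in 𝓝[≥] t, f v = f t) :
    ∃ k ≤ ⌊T / δ⌋₊ + 1, ∃ t ∈ gappedTimes T δ k, ∃ σ : Fin (k + 1) → S,
      ∀ u, f u = σ (stepIndex t u) := by
  classical
  obtain ⟨hfin, hcard⟩ := hf.finite_jumpTimes hδ
  have hcard' : hfin.toFinset.card = (jumpTimes f).ncard :=
    (Set.ncard_eq_toFinset_card _ hfin).symm
  let t : Fin (jumpTimes f).ncard → Set.Icc (0 : ℝ) T := hfin.toFinset.orderEmbOfFin hcard'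
  have ht : ∀ i, t i ∈ jumpTimes f := fun i =>
    hfin.mem_toFinset.1 (Finset.orderEmbOfFin_mem _ hcard' i)
  have hrange : ∀ w ∈ jumpTimes f, ∃ i, t i = w := by
    intro w hw
    have : w ∈ Set.range (hfin.toFinset.orderEmbOfFin hcard') := by
      rw [Finset.range_orderEmbOfFin]
      exact hfin.mem_toFinset.2 hw
    exact this
  have hconst : ∀ u v, u ≤ v → stepIndex t u = stepIndex t v → f u = f v := by
    intro u v huv h
    refine eq_of_forall_notMem_jumpTimes hr huv fun w huw hwv hw => ?_
    obtain ⟨i, rfl⟩ := hrange w hw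
    have hlt : (Finset.univ.filter fun j => t j ≤ u).card <
        (Finset.univ.filter fun j => t j ≤ v).card := by
      refine Finset.card_lt_card (Finset.ssubset_iff_subset_ne.2 ⟨?_, fun heq => ?_⟩)
      · exact Finset.monotone_filter_right _ fun j _ hj => le_trans hj huv
      · have : i ∈ Finset.univ.filter fun j => t j ≤ u := by
          rw [heq]
          simpa using hwv
        exact (not_le.2 huw) (Finset.mem_filter.1 this).2
    exact hlt.ne (Fin.ext_iff.1 h)
  -- The value at an index is read off at any time with that index; the default merely makes the
  -- function total.
  refine ⟨_, hcard, t, ⟨fun i j hij => ?_, fun i => hf.le_of_mem_jumpTimes (ht i),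
    fun i => hf.le_or_eq_of_mem_jumpTimes (ht i)⟩,
    fun n => if h : ∃ u, stepIndex t u = n then f h.choose else Classical.arbitrary S, fun u => ?_⟩
  · have hne : t i ≠ t j := fun h => hij ((hfin.toFinset.orderEmbOfFin hcard').injective h)
    rw [Subtype.dist_eq, Real.dist_eq]
    rcases lt_or_gt_of_ne hne with h | h
    · rw [abs_sub_comm]
      exact (hf.le_sub_of_mem_jumpTimes (ht i) (ht j) h).trans (le_abs_self _)
    · exact (hf.le_sub_of_mem_jumpTimes (ht j) (ht i) h).trans (le_abs_self _)
  · have h : ∃ v, stepIndex t v = stepIndex t u := ⟨u, rfl⟩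
    simp only [dif_pos h]
    rcases le_total u h.choose with hle | hle
    · exact hconst _ _ hle h.choose_spec.symm
    · exact (hconst _ _ hle h.choose_spec).symm

/-- The gap condition can be checked on a countable set of times. -/
theorem isGapped_iff_of_dense {δ : ℝ} (hr : ∀ t, ∀ᶠ v in 𝓝[≥] t, f v = f t)
    {Q : Set (Set.Icc (0 : ℝ) T)} (hQ : Dense Q) (hQT : ∀ t : Set.Icc (0 : ℝ) T, (t : ℝ) = T → t ∈ Q) :
    IsGapped δ f ↔
      (∀ s ∈ Q, ∀ t ∈ Q, ∀ u ∈ Q, s < t → t < u → (u : ℝ) - s < δ → f s = f t ∨ f t = f u) ∧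
      (∀ s ∈ Q, ∀ u ∈ Q, s < u → (u : ℝ) < δ → f s = f u) ∧
      (∀ s ∈ Q, ∀ u ∈ Q, s < u → T - δ < s → (u : ℝ) < T → f s = f u) := by
  refine ⟨fun h => ⟨fun s _ t _ u _ => h.window s t u, fun s _ u _ => h.left s u,
    fun s _ u _ => h.right s u⟩, fun ⟨h1, h2, h3⟩ => ?_⟩
  -- Each time can be pushed slightly to the right into `Q` without changing the value, while all
  -- strict inequalities survive. Only `T` cannot be moved, which is why `Q` must contain it.
  have happ : ∀ (c : Set.Icc (0 : ℝ) T) {r : ℝ}, (c : ℝ) < r →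
      ∃ q ∈ Q, c ≤ q ∧ (q : ℝ) < r ∧ f q = f c := by
    intro c r hcr
    by_cases hc : (c : ℝ) = T
    · exact ⟨c, hQT c hc, le_rfl, hcr, rfl⟩
    have hcT : (c : ℝ) < T := lt_of_le_of_ne c.2.2 hc
    obtain ⟨d, hd, hdf⟩ := Metric.eventually_nhds_iff.1 (eventually_nhdsWithin_iff.1 (hr c))
    have hm : (c : ℝ) < min r (min T (c + d)) := lt_min hcr (lt_min hcT (by linarith))
    have hopen : IsOpen {x : Set.Icc (0 : ℝ) T | (c : ℝ) < x ∧ (x : ℝ) < min r (min T (c + d))} :=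
      (isOpen_lt continuous_const continuous_subtype_val).inter
        (isOpen_lt continuous_subtype_val continuous_const)
    obtain ⟨b, hb1, hb2⟩ := exists_between hm
    obtain ⟨q, hqQ, hq1, hq2⟩ := hQ.exists_mem_open hopen ⟨⟨b, c.2.1.trans hb1.le,
      (hb2.trans_le ((min_le_right _ _).trans (min_le_left _ _))).le⟩, hb1, hb2⟩
    refine ⟨q, hqQ, le_of_lt hq1, hq2.trans_le (min_le_left _ _), hdf ?_ (le_of_lt hq1)⟩
    rw [Subtype.dist_eq, Real.dist_eq, abs_of_pos (sub_pos.2 hq1)]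
    linarith [hq2.trans_le ((min_le_right _ _).trans (min_le_right _ _))]
  refine ⟨fun s t u hst htu hsu => ?_, fun s u hsu hu => ?_, fun s u hsu hs hu => ?_⟩
  · obtain ⟨s', hs', hss', hs't, hfs⟩ := happ s hst
    obtain ⟨t', ht', htt', ht'u, hft⟩ := happ t htu
    obtain ⟨u', hu', huu', hu's, hfu⟩ := happ u (r := δ + s) (by linarith)
    rw [← hfs, ← hft, ← hfu]
    have hss'' : (s : ℝ) ≤ s' := hss'
    exact h1 s' hs' t' ht' u' hu' (lt_of_lt_of_le hs't htt') (lt_of_lt_of_le ht'u huu')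
      (by linarith)
  · obtain ⟨s', hs', hss', hs't, hfs⟩ := happ s hsu
    obtain ⟨u', hu', huu', hu's, hfu⟩ := happ u hu
    rw [← hfs, ← hfu]
    exact h2 s' hs' u' hu' (lt_of_lt_of_le hs't huu') hu's
  · obtain ⟨s', hs', hss', hs't, hfs⟩ := happ s hsu
    obtain ⟨u', hu', huu', hu's, hfu⟩ := happ u hu
    rw [← hfs, ← hfu]
    exact h3 s' hs' u' hu' (lt_of_lt_of_le hs't huu') (hs.trans_le hss') hu's

end GappedPaths

/-! ### Empirical measures: compactness for fixed `N`, limits as `N → ∞`. -/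

section EmpiricalMeasures

variable {T : ℝ}

/-- The empirical distribution of finitely many paths. -/
def empiricalOf {N : ℕ} [NeZero N] (X : Fin N → CadlagPath T unitInterval) :
    ProbabilityMeasure (CadlagPath T unitInterval) :=
  ⟨(N : ℝ≥0∞)⁻¹ • ∑ i : Fin N, Measure.dirac (X i), ⟨by
    simp [ENNReal.inv_mul_cancel, NeZero.ne N]⟩⟩

theorem PermPath.empirical_eq {N : ℕ} [NeZero N] (η : PermPath T N) :
    η.empirical = empiricalOf η.trajectory := rfl

theorem continuous_empiricalOf {N : ℕ} [NeZero N] :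
    Continuous (empiricalOf : (Fin N → CadlagPath T unitInterval) → _) := by
  refine continuous_iff_continuousAt.2 fun X => ?_
  refine ProbabilityMeasure.tendsto_iff_forall_integral_tendsto.2 fun f => ?_
  have h : ∀ Y : Fin N → CadlagPath T unitInterval,
      ∫ x, f x ∂(empiricalOf Y : Measure (CadlagPath T unitInterval)) =
        ((N : ℝ≥0∞)⁻¹).toReal * ∑ i, f (Y i) := by
    intro Y
    have : (empiricalOf Y : Measure (CadlagPath T unitInterval)) =
      (N : ℝ≥0∞)⁻¹ • ∑ i : Fin N, Measure.dirac (Y i) := rfl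
    rw [this, integral_smul_measure, integral_finsetSum_measure fun i _ => f.integrable _]
    simp
  simp only [h]
  have : Continuous fun Y : Fin N → CadlagPath T unitInterval =>
      ((N : ℝ≥0∞)⁻¹).toReal * ∑ i, f (Y i) :=
    continuous_const.mul (continuous_finsetSum _ fun i _ => f.continuous.comp (continuous_apply i))
  exact this.tendsto X

-- No measurability of `A` is needed: points are closed in the Hausdorff path space, so a Dirac mass
-- is an indicator on every set.
open Classical in
theorem PermPath.empirical_apply {N : ℕ} [NeZero N] (η : PermPath T N)
    (A : Set (CadlagPath T unitInterval)) :
    (η.empirical : Measure (CadlagPath T unitInterval)) A =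
      (N : ℝ≥0∞)⁻¹ * (Finset.univ.filter fun i => η.trajectory i ∈ A).card := by
  have : (η.empirical : Measure (CadlagPath T unitInterval)) =
      (N : ℝ≥0∞)⁻¹ • ∑ i : Fin N, Measure.dirac (η.trajectory i) := rfl
  rw [this, Measure.smul_apply, Measure.finsetSum_apply, smul_eq_mul]
  simp [Measure.dirac_apply, Set.indicator_apply, Finset.sum_boole]

theorem PermPath.trajectory_eq_stepPath {N k : ℕ} (η : PermPath T N)
    {t : Fin k → Set.Icc (0 : ℝ) T} {σ : Fin (k + 1) → Equiv.Perm (Fin N)}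
    (h : ∀ u, η u = σ (stepIndex t u)) (i : Fin N) :
    η.trajectory i = stepPath (fun n => sitePos (σ n i)) t := by
  ext u
  simp [PermPath.trajectory, stepPath, h]

/-- The permutation-valued step path. -/
def stepPermPath {N k : ℕ} (σ : Fin (k + 1) → Equiv.Perm (Fin N))
    (t : Fin k → Set.Icc (0 : ℝ) T) : PermPath T N :=
  ⟨fun u => σ (stepIndex t u), by
    let _ : TopologicalSpace (Equiv.Perm (Fin N)) := ⊥
    exact isCadlag_step t σ⟩

theorem exists_isCompact_trajectory (T : ℝ) (N : ℕ) {δ : ℝ} (hδ : 0 < δ) :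
    ∃ C : Set (CadlagPath T unitInterval), IsCompact C ∧
      ∀ η : PermPath T N, IsGapped δ η.toFun → ∀ i, η.trajectory i ∈ C := by
  refine ⟨⋃ k ∈ Set.Iic (⌊T / δ⌋₊ + 1), ⋃ σ : Fin (k + 1) → Equiv.Perm (Fin N), ⋃ i : Fin N,
    stepPath (fun n => sitePos (σ n i)) '' gappedTimes T δ k, ?_, fun η hη i => ?_⟩
  · refine (Set.finite_Iic _).isCompact_biUnion fun k _ => isCompact_iUnion fun σ =>
      isCompact_iUnion fun i => ?_
    exact (isCompact_gappedTimes T δ k).image_of_continuousOn (continuousOn_stepPath hδ _)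
  · obtain ⟨k, hk, t, ht, σ, h⟩ := hη.exists_eq_step hδ η.eventually_eq_right
    simp only [Set.mem_iUnion]
    exact ⟨k, hk, σ, i, t, ht, (η.trajectory_eq_stepPath h i).symm⟩

/-- The gap bounds the number of jumps, and there are finitely many sequences of values in the
symmetric group, so a finite union of continuous images of compact sets of jump times suffices. All
its points are empirical measures, which keeps closures inside `permutonSpace`. -/
theorem exists_isCompact_empirical (T : ℝ) (N : ℕ) [NeZero N] {δ : ℝ} (hδ : 0 < δ) :
    ∃ C : Set (ProbabilityMeasure (CadlagPath T unitInterval)), IsCompact C ∧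
      (∀ η : PermPath T N, IsGapped δ η.toFun → η.empirical ∈ C) ∧
      ∀ μ ∈ C, ∃ η : PermPath T N, μ = η.empirical := by
  refine ⟨⋃ k ∈ Set.Iic (⌊T / δ⌋₊ + 1), ⋃ σ : Fin (k + 1) → Equiv.Perm (Fin N),
    empiricalOf '' ((fun t i => stepPath (fun n => sitePos (σ n i)) t) '' gappedTimes T δ k),
    ?_, fun η hη => ?_, fun μ hμ => ?_⟩
  · refine (Set.finite_Iic _).isCompact_biUnion fun k _ => isCompact_iUnion fun σ => ?_
    refine ((isCompact_gappedTimes T δ k).image_of_continuousOn ?_).image continuous_empiricalOf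
    exact continuousOn_pi.2 fun i => continuousOn_stepPath hδ _
  · obtain ⟨k, hk, t, ht, σ, h⟩ := hη.exists_eq_step hδ η.eventually_eq_right
    simp only [Set.mem_iUnion]
    refine ⟨k, hk, σ, η.trajectory, ⟨t, ht, ?_⟩, η.empirical_eq.symm⟩
    exact funext fun i => (η.trajectory_eq_stepPath h i).symm
  · simp only [Set.mem_iUnion] at hμ
    obtain ⟨k, -, σ, _, ⟨t, -, rfl⟩, rfl⟩ := hμ
    exact ⟨stepPermPath σ t, rfl⟩

open Classical in
theorem le_card_sitePos_le {N : ℕ} [NeZero N] (y : unitInterval) :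
    (N : ℝ) * y - 1 ≤ (Finset.univ.filter fun x : Fin N => sitePos x ≤ y).card ∧
      (N : ℝ) * (1 - y) ≤ (Finset.univ.filter fun x : Fin N => y ≤ sitePos x).card := by
  have hN : (0 : ℝ) < N := by exact_mod_cast NeZero.pos N
  have hNy : 0 ≤ (N : ℝ) * y := mul_nonneg hN.le y.2.1
  have hcard : (Finset.univ.filter fun x : Fin N => (x : ℕ) < ⌊(N : ℝ) * y⌋₊).card
      = ⌊(N : ℝ) * y⌋₊ := by
    rw [Fin.card_filter_val_lt, min_eq_right]
    exact_mod_cast (Nat.floor_le hNy).trans (mul_le_of_le_one_right hN.le y.2.2)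
  have hiff : ∀ x : Fin N, (x : ℕ) < ⌊(N : ℝ) * y⌋₊ ↔ sitePos x ≤ y := by
    intro x
    rw [← Nat.succ_le_iff, Nat.le_floor_iff hNy, ← Subtype.coe_le_coe]
    change _ ↔ ((x : ℝ) + 1) / N ≤ y
    rw [div_le_iff₀' hN]
    push_cast
    rfl
  simp only [hiff] at hcard
  refine ⟨?_, ?_⟩
  · rw [hcard]
    linarith [Nat.lt_floor_add_one ((N : ℝ) * y)]
  · have h1 := Finset.card_filter_add_card_filter_not (s := Finset.univ)
      (fun x : Fin N => sitePos x ≤ y)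
    rw [hcard, Finset.card_univ, Fintype.card_fin] at h1
    have h2 : (Finset.univ.filter fun x : Fin N => ¬ sitePos x ≤ y).card ≤
        (Finset.univ.filter fun x : Fin N => y ≤ sitePos x).card :=
      Finset.card_le_card (Finset.monotone_filter_right _ fun x _ h => (not_le.1 h).le)
    have h3 : (N : ℝ) ≤ ⌊(N : ℝ) * y⌋₊ +
        (Finset.univ.filter fun x : Fin N => y ≤ sitePos x).card := by
      exact_mod_cast h1.symm.le.trans (by omega)
    linarith [Nat.floor_le hNy]

-- At a fixed time `η t` is a bijection, so the particles occupy every site exactly once and the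
-- marginal does not depend on `η`.
open Classical in
theorem PermPath.empirical_eval {N : ℕ} [NeZero N] (η : PermPath T N) (t : Set.Icc (0 : ℝ) T)
    (F : Set unitInterval) :
    (η.empirical : Measure (CadlagPath T unitInterval)) {X | X t ∈ F} =
      (N : ℝ≥0∞)⁻¹ * (Finset.univ.filter fun x : Fin N => sitePos x ∈ F).card := by
  rw [η.empirical_apply]
  congr 2
  refine Finset.card_bij (fun i _ => η t i) (fun i hi => ?_) (fun i _ j _ h => (η t).injective h)
    fun x hx => ⟨(η t).symm x, ?_, by simp⟩
  · exact Finset.mem_filter.2 ⟨Finset.mem_univ _, (Finset.mem_filter.1 hi).2⟩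
  · refine Finset.mem_filter.2 ⟨Finset.mem_univ _, ?_⟩
    change sitePos (η t ((η t).symm x)) ∈ F
    rw [Equiv.apply_symm_apply]
    exact (Finset.mem_filter.1 hx).2

theorem ofReal_le_inv_mul_of_mul_le {N n : ℕ} [NeZero N] {c : ℝ} (h : (N : ℝ) * c ≤ n) :
    ENNReal.ofReal c ≤ (N : ℝ≥0∞)⁻¹ * n := by
  have hN : (0 : ℝ) < N := by exact_mod_cast NeZero.pos N
  rw [← ENNReal.ofReal_natCast N, ← ENNReal.ofReal_natCast n, ← ENNReal.ofReal_inv_of_pos hN,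
    ← ENNReal.ofReal_mul (inv_nonneg.2 hN.le)]
  exact ENNReal.ofReal_le_ofReal ((le_inv_mul_iff₀ hN).2 h)

theorem PermPath.le_empirical_eval_le {N : ℕ} [NeZero N] (η : PermPath T N)
    (t : Set.Icc (0 : ℝ) T) (y : unitInterval) :
    ENNReal.ofReal (y - (N : ℝ)⁻¹) ≤
        (η.empirical : Measure (CadlagPath T unitInterval)) {X | X t ∈ Set.Iic y} ∧
      ENNReal.ofReal (1 - y) ≤
        (η.empirical : Measure (CadlagPath T unitInterval)) {X | X t ∈ Set.Ici y} := by
  classical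
  have hN : (0 : ℝ) < N := by exact_mod_cast NeZero.pos N
  obtain ⟨h1, h2⟩ := le_card_sitePos_le (N := N) y
  rw [η.empirical_eval, η.empirical_eval]
  refine ⟨ofReal_le_inv_mul_of_mul_le ?_, ofReal_le_inv_mul_of_mul_le ?_⟩
  · rw [mul_sub, mul_inv_cancel₀ hN.ne']
    simpa using h1
  · simpa using h2

/-- Lower bounds on closed sets are what weak limits preserve. The missing upper bound on `Iic y`
comes from the complements of `Ici z` with `z ↓ y`. -/
theorem eq_volume_of_le_Iic_of_le_Ici {ν : Measure unitInterval} [IsProbabilityMeasure ν]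
    (h₁ : ∀ y : unitInterval, ENNReal.ofReal y ≤ ν (Set.Iic y))
    (h₂ : ∀ y : unitInterval, ENNReal.ofReal (1 - y) ≤ ν (Set.Ici y)) : ν = volume := by
  refine Measure.ext_of_Iic _ _ fun y => ?_
  rw [unitInterval.volume_Iic]
  refine le_antisymm ?_ (h₁ y)
  have hIio : ∀ z : unitInterval, ν (Set.Iio z) ≤ ENNReal.ofReal z := by
    intro z
    rw [← Set.compl_Ici, prob_compl_eq_one_sub measurableSet_Ici]
    refine (tsub_le_tsub_left (h₂ z) 1).trans ?_
    rw [← ENNReal.ofReal_one, ← ENNReal.ofReal_sub _ (sub_nonneg.2 z.2.2), sub_sub_cancel]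
  rcases eq_or_lt_of_le y.2.2 with hy | hy
  · rw [hy, ENNReal.ofReal_one]
    exact prob_le_one
  · refine le_of_forall_gt_imp_ge_of_dense fun a ha => ?_
    have hcont : Tendsto (fun z : ℝ => ENNReal.ofReal z) (𝓝[>] (y : ℝ)) (𝓝 (ENNReal.ofReal y)) :=
      (ENNReal.continuous_ofReal.tendsto _).mono_left nhdsWithin_le_nhds
    obtain ⟨z, hz, hzy, hz1⟩ := ((hcont.eventually_lt_const ha).and
      (Ioo_mem_nhdsGT hy)).exists
    have := hIio ⟨z, y.2.1.trans hzy.le, hz1.le⟩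
    exact (measure_mono fun x hx => lt_of_le_of_lt hx (show y < ⟨z, _⟩ from hzy)).trans
      (this.trans hz.le)

/-- Limits of empirical measures of permutation paths with growing number of particles and a
uniform control on the moduli of continuity are permuton processes. -/
theorem isPermutonProcess_of_tendsto {ι : Type*} {L : Filter ι} [L.NeBot] {N : ι → ℕ+}
    {η : ∀ a, PermPath T (N a)} {π : ProbabilityMeasure (CadlagPath T unitInterval)}
    (hπ : Tendsto (fun a => (η a).empirical) L (𝓝 π)) (hN : Tendsto (fun a => (N a : ℕ)) L atTop)
    {δ ε : ℕ → ℝ} {e : ℕ → ℝ≥0∞} (hδ : ∀ j, 0 < δ j) (hε : Tendsto ε atTop (𝓝 0))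
    (he : ∑' j, e j ≠ ⊤)
    (h : ∀ j, ∀ᶠ a in L, ((η a).empirical : Measure (CadlagPath T unitInterval))
      (modulusSet T unitInterval (δ j) (ε j))ᶜ ≤ e j) : IsPermutonProcess π := by
  have hmod : ∀ j, (π : Measure (CadlagPath T unitInterval))
      (modulusSet T unitInterval (δ j) (ε j))ᶜ ≤ e j := fun j =>
    (ProbabilityMeasure.le_liminf_measure_open_of_tendsto hπ
      (isClosed_modulusSet _ _).isOpen_compl).trans (liminf_le_of_frequently_le' (h j).frequently)
  -- Borel–Cantelli: almost every path violates only finitely many of the moduli, and `ε j → 0`.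
  have hcont : ∀ᵐ γ ∂(π : Measure (CadlagPath T unitInterval)), Continuous γ.toFun := by
    have h0 : (π : Measure (CadlagPath T unitInterval))
        {X | ∃ᶠ j in atTop, X ∈ (modulusSet T unitInterval (δ j) (ε j))ᶜ} = 0 :=
      measure_setOfPred_frequently_eq_zero (ne_top_of_le_ne_top he (ENNReal.tsum_le_tsum hmod))
    refine measure_mono_null (fun X hX => ?_) h0
    by_contra hX'
    refine hX ?_
    change ¬ ∃ᶠ j in atTop, X ∉ modulusSet T unitInterval (δ j) (ε j) at hX'
    rw [not_frequently] at hX'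
    refine Metric.continuous_iff.2 fun t r hr => ?_
    obtain ⟨j, hj, hjr⟩ := (hX'.and (hε.eventually_lt_const hr)).exists
    exact ⟨δ j, hδ j, fun s hs => (not_not.1 hj s t hs).trans_lt hjr⟩
  refine ⟨hcont, fun t => ?_⟩
  -- Evaluation is continuous on the closed set of continuous paths, which has full measure.
  have hae : AEMeasurable (fun γ : CadlagPath T unitInterval => γ t)
      (π : Measure (CadlagPath T unitInterval)) := by
    have hc : ContinuousOn (fun γ : CadlagPath T unitInterval => γ t) {γ | Continuous γ.toFun} :=
      fun γ hγ => (CadlagPath.continuousAt_eval hγ t).continuousWithinAt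
    have := hc.aemeasurable (μ := (π : Measure (CadlagPath T unitInterval)))
      isClosed_setOf_continuous.measurableSet
    rwa [Measure.restrict_eq_self_of_ae_mem 
      (s := {γ : CadlagPath T unitInterval | Continuous γ.toFun}) hcont] at this
  -- The set `{X | X t ∈ F}` need not be closed, but its closure adds no continuous path, hence only
  -- a null set for `π`.
  have hclosed : ∀ F : Set unitInterval, IsClosed F →
      limsup (fun a => ((η a).empirical : Measure (CadlagPath T unitInterval)) {X | X t ∈ F}) L ≤
        (π : Measure (CadlagPath T unitInterval)).map (fun γ => γ t) F := by
    intro F hF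
    rw [Measure.map_apply_of_aemeasurable hae hF.measurableSet]
    calc limsup (fun a => ((η a).empirical : Measure (CadlagPath T unitInterval)) {X | X t ∈ F}) L
        ≤ limsup (fun a => ((η a).empirical : Measure (CadlagPath T unitInterval))
            (closure {X | X t ∈ F})) L :=
          limsup_le_limsup (Eventually.of_forall fun a => measure_mono subset_closure)
      _ ≤ (π : Measure (CadlagPath T unitInterval)) (closure {X | X t ∈ F}) :=
          ProbabilityMeasure.limsup_measure_closed_le_of_tendsto hπ isClosed_closure
      _ ≤ _ := by
          refine measure_mono_ae ?_
          filter_upwards [hcont] with X hX hXF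
          have h1 := ((CadlagPath.continuousAt_eval hX t).continuousWithinAt
            (s := {X : CadlagPath T unitInterval | X t ∈ F})).mem_closure (t := F) hXF
            fun Y hY => hY
          rwa [hF.closure_eq] at h1
  have hprob : IsProbabilityMeasure
      ((π : Measure (CadlagPath T unitInterval)).map fun γ => γ t) :=
    Measure.isProbabilityMeasure_map hae
  refine eq_volume_of_le_Iic_of_le_Ici (fun y => ?_) fun y => ?_
  · refine le_trans ?_ (hclosed _ isClosed_Iic)
    have hlim : Tendsto (fun a => ENNReal.ofReal (y - ((N a : ℕ) : ℝ)⁻¹)) L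
        (𝓝 (ENNReal.ofReal y)) := by
      refine (ENNReal.continuous_ofReal.tendsto _).comp ?_
      have := (tendsto_inv_atTop_nhds_zero_nat (𝕜 := ℝ)).comp hN
      simpa using this.const_sub (y : ℝ)
    rw [← hlim.limsup_eq]
    exact limsup_le_limsup (Eventually.of_forall fun a => ((η a).le_empirical_eval_le t y).1)
  · refine le_trans ?_ (hclosed _ isClosed_Ici)
    exact le_limsup_of_frequently_le' (Eventually.of_forall fun a =>
      ((η a).le_empirical_eval_le t y).2).frequently

end EmpiricalMeasures

/-! ### Exponentials of matrices with nonnegative off-diagonal entries. -/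

section Semigroup

open scoped Matrix Matrix.Norms.Operator

variable {n : Type*} [Fintype n] [DecidableEq n]

theorem Matrix.hasSum_exp_mulVec (A : Matrix n n ℝ) (f : n → ℝ) (i : n) :
    HasSum (fun k : ℕ => ((k.factorial : ℝ)⁻¹) * (A ^ k *ᵥ f) i) ((NormedSpace.exp A *ᵥ f) i) := by
  have h := NormedSpace.exp_series_hasSum_exp' (𝕂 := ℝ) A
  let φ : Matrix n n ℝ →+ ℝ :=
    { toFun := fun M => (M *ᵥ f) i
      map_zero' := by simp
      map_add' := fun M M' => by simp [Matrix.add_mulVec] }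
  have hφ : Continuous φ := by
    change Continuous fun M : Matrix n n ℝ => ∑ j, M i j * f j
    fun_prop
  have := h.map φ hφ
  convert! this using 2 with k
  simp [φ, Matrix.smul_mulVec]

theorem Matrix.exp_mulVec_le_of_nonneg {A : Matrix n n ℝ} (hA : ∀ i j, 0 ≤ A i j) {f : n → ℝ}
    {c : ℝ} (hc : 0 ≤ c) (h : ∀ i, (A *ᵥ f) i ≤ c * f i) (i : n) :
    (NormedSpace.exp A *ᵥ f) i ≤ Real.exp c * f i := by
  have hpow : ∀ k i, (A ^ k *ᵥ f) i ≤ c ^ k * f i := by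
    intro k
    induction k with
    | zero => simp
    | succ k ih =>
      intro i
      rw [pow_succ', ← Matrix.mulVec_mulVec]
      calc (A *ᵥ (A ^ k *ᵥ f)) i = ∑ j, A i j * (A ^ k *ᵥ f) j := rfl
        _ ≤ ∑ j, A i j * (c ^ k * f j) :=
            Finset.sum_le_sum fun j _ => mul_le_mul_of_nonneg_left (ih j) (hA i j)
        _ = c ^ k * (A *ᵥ f) i := by
            rw [Matrix.mulVec, dotProduct, Finset.mul_sum]
            exact Finset.sum_congr rfl fun j _ => by ring
        _ ≤ c ^ k * (c * f i) := mul_le_mul_of_nonneg_left (h i) (pow_nonneg hc k)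
        _ = c ^ (k + 1) * f i := by ring
  have h2 := (NormedSpace.exp_series_hasSum_exp' (𝕂 := ℝ) c).mul_right (f i)
  rw [← Real.exp_eq_exp_ℝ] at h2
  refine hasSum_le (fun k => ?_) (A.hasSum_exp_mulVec f i) h2
  rw [smul_eq_mul, mul_assoc]
  exact mul_le_mul_of_nonneg_left (hpow k i) (by positivity)

theorem Matrix.exp_nonneg_of_nonneg {A : Matrix n n ℝ} (hA : ∀ i j, 0 ≤ A i j) (i j : n) :
    0 ≤ NormedSpace.exp A i j := by
  have h := A.hasSum_exp_mulVec (Pi.single j 1) i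
  simp only [Matrix.mulVec_single_one, Matrix.col_apply] at h
  have hpow : ∀ k i j, 0 ≤ (A ^ k) i j := by
    intro k
    induction k with
    | zero =>
      intro i j
      rw [pow_zero, Matrix.one_apply]
      split_ifs <;> norm_num
    | succ k ih =>
      intro i j
      rw [pow_succ, Matrix.mul_apply]
      exact Finset.sum_nonneg fun l _ => mul_nonneg (ih i l) (hA l j)
  exact h.nonneg fun k => mul_nonneg (by positivity) (hpow k i j)

theorem Matrix.exp_add_smul_one (A : Matrix n n ℝ) (b : ℝ) :
    NormedSpace.exp (A + b • (1 : Matrix n n ℝ)) = Real.exp b • NormedSpace.exp A := by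
  have h1 : NormedSpace.exp (b • (1 : Matrix n n ℝ)) = Real.exp b • (1 : Matrix n n ℝ) := by
    rw [Matrix.smul_one_eq_diagonal, Matrix.smul_one_eq_diagonal, Matrix.exp_diagonal,
      Real.exp_eq_exp_ℝ]
    congr 1
    ext i
    rw [Pi.coe_exp]
  rw [Matrix.exp_add_of_commute _ _ ((Commute.one_right A).smul_right b), h1, mul_smul_comm, mul_one]

/-- Adding `b • 1` multiplies the exponential by the scalar `e^b`, so positivity and comparison
reduce to entrywise nonnegative matrices, where the power series can be estimated term by term. -/
theorem Matrix.exists_shift_nonneg {A : Matrix n n ℝ} (hA : ∀ i j, i ≠ j → 0 ≤ A i j) (c : ℝ) :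
    ∃ b : ℝ, 0 ≤ c + b ∧ ∀ i j, 0 ≤ (A + b • (1 : Matrix n n ℝ)) i j := by
  refine ⟨|c| + ∑ i, |A i i|, ?_, fun i j => ?_⟩
  · have : 0 ≤ ∑ i, |A i i| := Finset.sum_nonneg fun i _ => abs_nonneg _
    linarith [neg_abs_le c]
  · rw [Matrix.add_apply, Matrix.smul_apply, Matrix.one_apply]
    split_ifs with hij
    · subst hij
      have := Finset.single_le_sum (f := fun i => |A i i|) (fun i _ => abs_nonneg _)
        (Finset.mem_univ i)
      simp only [smul_eq_mul, mul_one]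
      linarith [neg_abs_le (A i i), abs_nonneg c]
    · simpa using hA i j hij

/-- Comparison principle for the semigroup of a matrix with nonnegative off-diagonal entries. -/
theorem Matrix.exp_mulVec_le {A : Matrix n n ℝ} (hA : ∀ i j, i ≠ j → 0 ≤ A i j) {f : n → ℝ}
    {c : ℝ} (h : ∀ i, (A *ᵥ f) i ≤ c * f i) (i : n) :
    (NormedSpace.exp A *ᵥ f) i ≤ Real.exp c * f i := by
  obtain ⟨b, hb, hAb⟩ := Matrix.exists_shift_nonneg hA c
  have := Matrix.exp_mulVec_le_of_nonneg (f := f) hAb hb (fun i => by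
    rw [Matrix.add_mulVec, Matrix.smul_mulVec, Matrix.one_mulVec, Pi.add_apply, Pi.smul_apply,
      smul_eq_mul, add_mul]
    linarith [h i]) i
  rw [Matrix.exp_add_smul_one, Matrix.smul_mulVec, Pi.smul_apply, smul_eq_mul, add_comm,
    Real.exp_add, mul_assoc] at this
  exact le_of_mul_le_mul_left this (Real.exp_pos b)

theorem Matrix.exp_nonneg {A : Matrix n n ℝ} (hA : ∀ i j, i ≠ j → 0 ≤ A i j) (i j : n) :
    0 ≤ NormedSpace.exp A i j := by
  obtain ⟨b, -, hAb⟩ := Matrix.exists_shift_nonneg hA 0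
  have := Matrix.exp_nonneg_of_nonneg hAb i j
  rw [Matrix.exp_add_smul_one, Matrix.smul_apply, smul_eq_mul] at this
  exact nonneg_of_mul_nonneg_right this (Real.exp_pos b)

end Semigroup

/-! ### The generator on exponentials of linear statistics. -/

section Generator

open scoped Matrix

variable {α : ℝ} {N : ℕ}

theorem interchangeRates_mulVec (f : Equiv.Perm (Fin N) → ℝ) (σ : Equiv.Perm (Fin N)) :
    (interchangeRates α N *ᵥ f) σ = interchangeGenerator α N f σ := by
  simp only [Matrix.mulVec, dotProduct, interchangeRates, Matrix.of_apply, interchangeGenerator]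
  simp only [mul_assoc, ← Finset.mul_sum, Finset.sum_mul]
  rw [Finset.sum_comm]
  congr 2
  refine Finset.sum_congr rfl fun x _ => ?_
  simp [sub_mul, Finset.sum_sub_distrib, Pi.single_apply]

theorem interchangeRates_nonneg (σ τ : Equiv.Perm (Fin N)) (h : σ ≠ τ) :
    0 ≤ interchangeRates α N σ τ := by
  simp only [interchangeRates, Matrix.of_apply, interchangeGenerator]
  refine mul_nonneg (by positivity) (Finset.sum_nonneg fun x _ => ?_)
  rw [Pi.single_eq_of_ne h, sub_zero, Pi.single_apply]
  split_ifs <;> norm_num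

theorem interchangeKernel_nonneg {t : ℝ} (ht : 0 ≤ t) (σ τ : Equiv.Perm (Fin N)) :
    0 ≤ interchangeKernel α N t σ τ :=
  Matrix.exp_nonneg (fun σ τ h => mul_nonneg ht (interchangeRates_nonneg σ τ h)) σ τ

theorem sum_interchangeKernel_mul_le {t : ℝ} (ht : 0 ≤ t) {f : Equiv.Perm (Fin N) → ℝ} {c : ℝ}
    (h : ∀ σ, interchangeGenerator α N f σ ≤ c * f σ) (σ : Equiv.Perm (Fin N)) :
    ∑ τ, interchangeKernel α N t σ τ * f τ ≤ Real.exp (t * c) * f σ := by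
  refine Matrix.exp_mulVec_le (A := t • interchangeRates α N) (fun σ τ h => mul_nonneg ht (interchangeRates_nonneg σ τ h))
    (fun σ => ?_) σ
  rw [Matrix.smul_mulVec, Pi.smul_apply, smul_eq_mul, interchangeRates_mulVec, mul_assoc]
  exact mul_le_mul_of_nonneg_left (h σ) ht

/-- The swap moves the particle at `x` up by one, the one at `x + 1` down by one, and no other. -/
theorem sum_mul_swapAt (v : Fin N → ℝ) (σ : Equiv.Perm (Fin N)) (x : Fin (N - 1)) :
    ∑ i, v i * (swapAt x σ i : ℝ) = ∑ i, v i * (σ i : ℝ) +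
      (v (σ.symm ⟨x, by omega⟩) - v (σ.symm ⟨x + 1, by omega⟩)) := by
  rw [← sub_eq_iff_eq_add', ← Finset.sum_sub_distrib]
  set a : Fin N := ⟨x, by omega⟩ with ha
  set b : Fin N := ⟨x + 1, by omega⟩ with hb
  have hab : a ≠ b := by simp [ha, hb, Fin.ext_iff]
  have hsw : ∀ i, swapAt x σ i = Equiv.swap a b (σ i) := fun i => rfl
  simp only [hsw]
  rw [← Equiv.sum_comp σ.symm]
  simp only [Equiv.apply_symm_apply]
  rw [Finset.sum_eq_add a b hab (fun c _ hc => by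
    rw [Equiv.swap_apply_of_ne_of_ne hc.1 hc.2, sub_self]) (by simp) (by simp),
    Equiv.swap_apply_left, Equiv.swap_apply_right]
  simp only [ha, hb]
  push_cast
  ring

/-- The first sum telescopes to a difference of boundary values and is bounded independently of `N`;
this keeps the drift cost at order `N`. The second uses `(a - b)² ≤ 2a² + 2b²`. -/
theorem sum_sub_and_sum_sq_le {w : Fin N → ℝ} (hw : ∀ x, |w x| ≤ 1) :
    ∑ x : Fin (N - 1), (w ⟨x, by omega⟩ - w ⟨x + 1, by omega⟩) ≤ 2 ∧
      ∑ x : Fin (N - 1), (w ⟨x, by omega⟩ - w ⟨x + 1, by omega⟩) ^ 2 ≤ 4 * ∑ x, w x ^ 2 := by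
  let g : ℕ → ℝ := fun m => if h : m < N then w ⟨m, h⟩ else 0
  have hg : ∀ m, |g m| ≤ 1 := by
    intro m
    simp only [g]
    split_ifs with h
    · exact hw _
    · simp
  have hdiff : ∀ x : Fin (N - 1),
      w ⟨x, by omega⟩ - w ⟨x + 1, by omega⟩ = g x - g (x + 1) := by
    intro x
    simp only [g]
    rw [dif_pos (by omega), dif_pos (by omega)]
  have hsum : ∑ x, w x ^ 2 = ∑ m ∈ Finset.range N, g m ^ 2 := by
    rw [← Fin.sum_univ_eq_sum_range]
    exact Finset.sum_congr rfl fun x _ => by simp [g]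
  simp only [hdiff, hsum]
  rw [Fin.sum_univ_eq_sum_range (fun m => g m - g (m + 1)),
    Fin.sum_univ_eq_sum_range (fun m => (g m - g (m + 1)) ^ 2), Finset.sum_range_sub']
  constructor
  · linarith [(abs_le.1 (hg 0)).2, (abs_le.1 (hg (N - 1))).1]
  · have h1 : ∑ m ∈ Finset.range (N - 1), g m ^ 2 ≤ ∑ m ∈ Finset.range N, g m ^ 2 :=
      Finset.sum_le_sum_of_subset_of_nonneg (Finset.range_mono (Nat.sub_le _ _))
        fun m _ _ => sq_nonneg _
    have h2 : ∑ m ∈ Finset.range (N - 1), g (m + 1) ^ 2 ≤ ∑ m ∈ Finset.range N, g m ^ 2 := by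
      rcases Nat.eq_zero_or_pos N with rfl | hN
      · simp
      · conv_rhs => rw [← Nat.sub_add_cancel hN, Finset.sum_range_succ']
        linarith [sq_nonneg (g 0)]
    calc ∑ m ∈ Finset.range (N - 1), (g m - g (m + 1)) ^ 2
        ≤ ∑ m ∈ Finset.range (N - 1), (2 * g m ^ 2 + 2 * g (m + 1) ^ 2) :=
          Finset.sum_le_sum fun m _ => by nlinarith [sq_nonneg (g m + g (m + 1))]
      _ ≤ _ := by
          rw [Finset.sum_add_distrib, ← Finset.mul_sum, ← Finset.mul_sum]
          linarith

/-- The generator applied to an exponential of a linear statistic of the positions. The first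
order terms telescope. -/
theorem interchangeGenerator_exp_le {v : Fin N → ℝ} (hv : ∀ i, |v i| ≤ 1) {l : ℝ} (hl : 0 ≤ l)
    (hl' : 2 * l ≤ 1) (σ : Equiv.Perm (Fin N)) :
    interchangeGenerator α N (fun τ => Real.exp (l * ∑ i, v i * (τ i : ℝ))) σ ≤
      (N : ℝ) ^ α * (l + 2 * l ^ 2 * ∑ i, v i ^ 2) *
        Real.exp (l * ∑ i, v i * (σ i : ℝ)) := by
  obtain ⟨h1, h2⟩ := sum_sub_and_sum_sq_le (w := fun p => v (σ.symm p)) fun p => hv _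
  rw [Equiv.sum_comp σ.symm fun i => v i ^ 2] at h2
  set E := Real.exp (l * ∑ i, v i * (σ i : ℝ)) with hE
  have hE0 : 0 ≤ E := (Real.exp_pos _).le
  have hterm : ∀ x : Fin (N - 1), Real.exp (l * ∑ i, v i * (swapAt x σ i : ℝ)) - E ≤
      (l * (v (σ.symm ⟨x, by omega⟩) - v (σ.symm ⟨x + 1, by omega⟩)) +
        l ^ 2 * (v (σ.symm ⟨x, by omega⟩) - v (σ.symm ⟨x + 1, by omega⟩)) ^ 2) * E := by
    intro x
    rw [sum_mul_swapAt, mul_add, Real.exp_add, ← hE]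
    set d := v (σ.symm ⟨x, by omega⟩) - v (σ.symm ⟨x + 1, by omega⟩) with hd
    have hd2 : |d| ≤ 2 := by
      refine (abs_sub _ _).trans ?_
      linarith [hv (σ.symm ⟨x, by omega⟩), hv (σ.symm ⟨x + 1, by omega⟩)]
    have hld : |l * d| ≤ 1 := by
      rw [abs_mul, abs_of_nonneg hl]
      nlinarith
    -- The bound `e^z ≤ 1 + z + z²` for `|z| ≤ 1`; the condition `2 * l ≤ 1` is there because `|d| ≤
    -- 2`.
    have := (abs_le.1 (Real.abs_exp_sub_one_sub_id_le hld)).2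
    nlinarith
  have hsum : ∑ x : Fin (N - 1), (Real.exp (l * ∑ i, v i * (swapAt x σ i : ℝ)) - E) ≤
      (2 * l + 4 * l ^ 2 * ∑ i, v i ^ 2) * E := by
    refine (Finset.sum_le_sum fun x _ => hterm x).trans ?_
    rw [← Finset.sum_mul, Finset.sum_add_distrib, ← Finset.mul_sum, ← Finset.mul_sum]
    refine mul_le_mul_of_nonneg_right ?_ hE0
    have h3 := mul_le_mul_of_nonneg_left h1 hl
    have h4 := mul_le_mul_of_nonneg_left h2 (sq_nonneg l)
    linarith
  have hN : 0 ≤ 1 / 2 * (N : ℝ) ^ α := by positivity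
  calc interchangeGenerator α N (fun τ => Real.exp (l * ∑ i, v i * (τ i : ℝ))) σ
      ≤ 1 / 2 * (N : ℝ) ^ α * ((2 * l + 4 * l ^ 2 * ∑ i, v i ^ 2) * E) :=
        mul_le_mul_of_nonneg_left hsum hN
    _ = _ := by ring

theorem sum_interchangeKernel_mul_exp_le {v : Fin N → ℝ} (hv : ∀ i, |v i| ≤ 1) {l : ℝ}
    (hl : 0 ≤ l) (hl' : 2 * l ≤ 1) {t : ℝ} (ht : 0 ≤ t) (σ : Equiv.Perm (Fin N)) :
    ∑ τ, interchangeKernel α N t σ τ * Real.exp (l * ∑ i, v i * ((τ i : ℝ) - σ i)) ≤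
      Real.exp (t * ((N : ℝ) ^ α * (l + 2 * l ^ 2 * ∑ i, v i ^ 2))) := by
  have h := sum_interchangeKernel_mul_le ht
    (fun σ => interchangeGenerator_exp_le (α := α) hv hl hl' σ) σ
  have h2 : ∀ τ : Equiv.Perm (Fin N), Real.exp (l * ∑ i, v i * (τ i : ℝ)) =
      Real.exp (l * ∑ i, v i * ((τ i : ℝ) - σ i)) * Real.exp (l * ∑ i, v i * (σ i : ℝ)) := by
    intro τ
    rw [← Real.exp_add, ← mul_add, ← Finset.sum_add_distrib]
    simp only [mul_sub, sub_add_cancel]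
  rw [Finset.sum_congr rfl fun τ _ => by rw [h2 τ, ← mul_assoc], ← Finset.sum_mul] at h
  exact le_of_mul_le_mul_right h (Real.exp_pos _)

end Generator

/-! ### A discrete supermartingale inequality. -/

section PathWeights

variable {S : Type*} [Fintype S]

/-- A supermartingale estimate for a functional of the path of a Markov chain. -/
theorem sum_pathWeight_mul_le {p : S → S → ℝ} {q : S → ℝ} (hp : ∀ x y, 0 ≤ p x y)
    (hq : ∀ x, 0 ≤ q x) {c : ℕ → ℝ} (hc : ∀ n, 0 ≤ c n) {Z : ∀ n, (Fin (n + 1) → S) → ℝ}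
    (h0 : ∀ σ, Z 0 σ ≤ 1)
    (hZ : ∀ n (σ : Fin (n + 1) → S),
      ∑ y, p (σ (Fin.last n)) y * Z (n + 1) (Fin.snoc σ y) ≤ c n * Z n σ) (n : ℕ) :
    ∑ σ : Fin (n + 1) → S, (q (σ 0) * ∏ j : Fin n, p (σ j.castSucc) (σ j.succ)) * Z n σ ≤
      (∑ x, q x) * ∏ j ∈ Finset.range n, c j := by
  induction n with
  | zero =>
    rw [← (Equiv.funUnique (Fin 1) S).symm.sum_comp]
    simp only [Finset.univ_eq_empty, Finset.prod_empty, mul_one, Finset.range_zero]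
    exact Finset.sum_le_sum fun x _ => mul_le_of_le_one_right (hq _) (h0 _)
  | succ n ih =>
    rw [← (Fin.snocEquiv fun _ : Fin (n + 2) => S).sum_comp, Fintype.sum_prod_type,
      Finset.sum_comm]
    calc ∑ σ : Fin (n + 1) → S, ∑ y : S, _
        = ∑ σ : Fin (n + 1) → S, (q (σ 0) * ∏ j : Fin n, p (σ j.castSucc) (σ j.succ)) *
            ∑ y, p (σ (Fin.last n)) y * Z (n + 1) (Fin.snoc σ y) := by
          refine Finset.sum_congr rfl fun σ _ => ?_
          rw [Finset.mul_sum]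
          refine Finset.sum_congr rfl fun y _ => ?_
          change (q ((Fin.snoc σ y : Fin (n + 2) → S) 0) * ∏ j : Fin (n + 1),
            p ((Fin.snoc σ y : Fin (n + 2) → S) j.castSucc)
              ((Fin.snoc σ y : Fin (n + 2) → S) j.succ)) * Z (n + 1) (Fin.snoc σ y) = _
          rw [Fin.prod_univ_castSucc]
          have h1 : (Fin.snoc σ y : Fin (n + 2) → S) 0 = σ 0 :=
            Fin.snoc_castSucc (α := fun _ => S) y σ 0
          have h2 : ∀ j : Fin (n + 1), (Fin.snoc σ y : Fin (n + 2) → S) j.castSucc = σ j :=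
            fun j => Fin.snoc_castSucc (α := fun _ => S) y σ j
          have h3 : ∀ j : Fin n, (Fin.snoc σ y : Fin (n + 2) → S) j.castSucc.succ = σ j.succ :=
            fun j => by rw [Fin.succ_castSucc]; exact h2 _
          have h4 : (Fin.snoc σ y : Fin (n + 2) → S) (Fin.last n).succ = y :=
            Fin.snoc_last (α := fun _ => S) y σ
          simp only [h1, h2, h3, h4]
          ring
      _ ≤ ∑ σ : Fin (n + 1) → S, (q (σ 0) * ∏ j : Fin n, p (σ j.castSucc) (σ j.succ)) *
            (c n * Z n σ) :=
          Finset.sum_le_sum fun σ _ => mul_le_mul_of_nonneg_left (hZ n σ)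
            (mul_nonneg (hq _) (Finset.prod_nonneg fun j _ => hp _ _))
      _ = c n * ∑ σ : Fin (n + 1) → S,
            (q (σ 0) * ∏ j : Fin n, p (σ j.castSucc) (σ j.succ)) * Z n σ := by
          rw [Finset.mul_sum]
          exact Finset.sum_congr rfl fun σ _ => by ring
      _ ≤ c n * ((∑ x, q x) * ∏ j ∈ Finset.range n, c j) := mul_le_mul_of_nonneg_left ih (hc n)
      _ = _ := by
          rw [Finset.prod_range_succ]
          ring

end PathWeights

/-! ### Finite paths as sequences indexed by all times. -/

section ExtendPath

variable {S : Type*}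

/-- Extension of a finite path to all times, constant after its end. -/
def extendPath {n : ℕ} (σ : Fin (n + 1) → S) (m : ℕ) : S :=
  σ ⟨min m n, Nat.lt_succ_of_le (min_le_right _ _)⟩

theorem extendPath_snoc {n m : ℕ} (σ : Fin (n + 1) → S) (y : S) (hm : m ≤ n) :
    extendPath (Fin.snoc σ y : Fin (n + 2) → S) m = extendPath σ m := by
  have h : (⟨min m (n + 1), Nat.lt_succ_of_le (min_le_right _ _)⟩ : Fin (n + 2)) =
      Fin.castSucc ⟨min m n, Nat.lt_succ_of_le (min_le_right _ _)⟩ := by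
    ext
    simp only [Fin.val_castSucc]
    omega
  rw [extendPath, h, Fin.snoc_castSucc, extendPath]

theorem extendPath_snoc_last {n : ℕ} (σ : Fin (n + 1) → S) (y : S) :
    extendPath (Fin.snoc σ y : Fin (n + 2) → S) (n + 1) = y := by
  have h : (⟨min (n + 1) (n + 1), Nat.lt_succ_of_le (min_le_right _ _)⟩ : Fin (n + 2)) =
      Fin.last (n + 1) := by
    ext
    simp
  rw [extendPath, h, Fin.snoc_last]

theorem extendPath_last {n : ℕ} (σ : Fin (n + 1) → S) : extendPath σ n = σ (Fin.last n) := by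
  have h : (⟨min n n, Nat.lt_succ_of_le (min_le_right _ _)⟩ : Fin (n + 1)) = Fin.last n := by
    ext
    simp
  rw [extendPath, h]

end ExtendPath

/-! ### Displacement of the particles until they reach their targets. -/

section StoppedDisplacement

/-- The sign encoded by a Boolean. -/
def boolSign (b : Bool) : ℝ := if b then 1 else -1

theorem abs_boolSign (b : Bool) : |boolSign b| = 1 := by cases b <;> simp [boolSign]

variable {N M : ℕ}

/-- A particle with real-valued position `x` is still watched at the time `j` if its window
`[k r, (k + 1) r)` contains `j` and its displacement from the beginning of the window in the
direction `b` has not reached `R` up to time `j`. -/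
def IsWatched (r : ℕ) (R : ℝ) (x : ℕ → ℝ) (k : ℕ) (b : Bool) (j : ℕ) : Prop :=
  (k * r ≤ j ∧ j < (k + 1) * r) ∧
    ∀ l, k * r ≤ l → l ≤ j → boolSign b * (x l - x (k * r)) < R

theorem IsWatched.congr {r : ℕ} {R : ℝ} {x y : ℕ → ℝ} {k : ℕ} {b : Bool} {j : ℕ}
    (h : ∀ l ≤ j, x l = y l) : IsWatched r R x k b j ↔ IsWatched r R y k b j := by
  refine and_congr_right fun hj => forall_congr' fun l => imp_congr_right fun _ =>
    imp_congr_right fun hl => ?_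
  rw [h l hl, h _ hj.1]

open Classical in
/-- The displacement of the particle while it is watched reaches `R` if the particle does. -/
theorem le_sum_watched {r n : ℕ} {R : ℝ} {x : ℕ → ℝ} {k : ℕ} {b : Bool} (hn : (k + 1) * r ≤ n)
    (h : ∃ l, k * r ≤ l ∧ l ≤ (k + 1) * r ∧ R ≤ boolSign b * (x l - x (k * r))) :
    R ≤ boolSign b * ∑ j ∈ Finset.range n,
      if IsWatched r R x k b j then x (j + 1) - x j else 0 := by
  -- At the first hitting time `l` watching stops: the watched times are exactly `[k r, l)`, and the
  -- increments telescope to the displacement at `l`.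
  set l := Nat.find h with hl
  obtain ⟨hl1, hl2, hl3⟩ : k * r ≤ l ∧ l ≤ (k + 1) * r ∧ R ≤ boolSign b * (x l - x (k * r)) :=
    Nat.find_spec h
  have hset : (Finset.range n).filter (IsWatched r R x k b) = Finset.Ico (k * r) l := by
    ext j
    simp only [Finset.mem_filter, Finset.mem_range, Finset.mem_Ico]
    constructor
    · rintro ⟨-, ⟨hj1, -⟩, hj3⟩
      refine ⟨hj1, ?_⟩
      by_contra! hlj
      exact absurd hl3 (not_le.2 (hj3 l hl1 hlj))
    · rintro ⟨hj1, hj2⟩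
      refine ⟨by omega, ⟨hj1, by omega⟩, fun l' hl'1 hl'2 => ?_⟩
      by_contra! hl'3
      exact Nat.find_min h (lt_of_le_of_lt hl'2 hj2) ⟨hl'1, by omega, hl'3⟩
  rw [← Finset.sum_filter, hset, Finset.sum_Ico_eq_sub _ hl1, Finset.sum_range_sub,
    Finset.sum_range_sub, sub_sub_sub_cancel_right]
  exact hl3

/-- The direction in which a particle is watched at time `j`: a particle `i` with `ψ i = none` is
never watched, one with `ψ i = some (k, b)` is watched in the window `k` in the direction `b`. -/
def watchDirection (r : ℕ) (R : ℝ) (ψ : Fin N → Option (Fin M × Bool))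
    (h : ℕ → Equiv.Perm (Fin N)) (j : ℕ) (i : Fin N) : ℝ :=
  open Classical in
  match ψ i with
  | none => 0
  | some (k, b) => if IsWatched r R (fun l => (h l i : ℝ)) k b j then boolSign b else 0

/-- The indicator function of the windows of the particles. -/
def windowIndicator (r : ℕ) (ψ : Fin N → Option (Fin M × Bool)) (j : ℕ) (i : Fin N) : ℝ :=
  match ψ i with
  | none => 0
  | some (k, _) => if k * r ≤ j ∧ j < (k + 1) * r then 1 else 0

variable {r : ℕ} {R : ℝ} {ψ : Fin N → Option (Fin M × Bool)} {h : ℕ → Equiv.Perm (Fin N)}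

theorem watchDirection_congr {h' : ℕ → Equiv.Perm (Fin N)} {j : ℕ} (hh : ∀ l ≤ j, h l = h' l)
    (i : Fin N) : watchDirection r R ψ h j i = watchDirection r R ψ h' j i := by
  unfold watchDirection
  split
  · rfl
  · rw [IsWatched.congr fun l hl => by rw [hh l hl]]

theorem abs_watchDirection_le (j : ℕ) (i : Fin N) : |watchDirection r R ψ h j i| ≤ 1 := by
  unfold watchDirection
  split
  · simp
  · split_ifs <;> simp [abs_boolSign]

theorem watchDirection_sq_le (j : ℕ) (i : Fin N) :
    watchDirection r R ψ h j i ^ 2 ≤ windowIndicator r ψ j i := by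
  unfold watchDirection windowIndicator
  cases ψ i with
  | none => simp
  | some kb =>
    dsimp only
    split_ifs with h1 h2 h2
    · rw [← sq_abs, abs_boolSign, one_pow]
    · exact absurd h1.1 h2
    · norm_num
    · norm_num

theorem sum_windowIndicator_le (n : ℕ) (i : Fin N) :
    ∑ j ∈ Finset.range n, windowIndicator r ψ j i ≤ r := by
  unfold windowIndicator
  split
  · simp
  · rename_i k b heq
    rw [← Finset.sum_filter, Finset.sum_const, nsmul_eq_mul, mul_one]
    have : (Finset.range n).filter (fun j => (k : ℕ) * r ≤ j ∧ j < (k + 1) * r) ⊆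
        Finset.Ico (k * r) ((k + 1) * r) := fun j hj =>
      Finset.mem_Ico.2 (Finset.mem_filter.1 hj).2
    have h2 : _ ≤ r := (Finset.card_le_card this).trans
      (by rw [Nat.card_Ico, ← Nat.sub_mul, Nat.add_sub_cancel_left, one_mul])
    exact_mod_cast h2

/-- The total displacement of all particles in their directions while they are watched. -/
def watchedDisplacement (r : ℕ) (R : ℝ) (ψ : Fin N → Option (Fin M × Bool))
    (h : ℕ → Equiv.Perm (Fin N)) (n : ℕ) : ℝ :=
  ∑ j ∈ Finset.range n, ∑ i, watchDirection r R ψ h j i * ((h (j + 1) i : ℝ) - h j i)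

theorem watchedDisplacement_congr {h' : ℕ → Equiv.Perm (Fin N)} {n : ℕ}
    (hh : ∀ l ≤ n, h l = h' l) :
    watchedDisplacement r R ψ h n = watchedDisplacement r R ψ h' n := by
  refine Finset.sum_congr rfl fun j hj => Finset.sum_congr rfl fun i _ => ?_
  have hj' := Finset.mem_range.1 hj
  rw [watchDirection_congr (fun l hl => hh l (by omega)), hh j hj'.le, hh (j + 1) hj']

/-- All particles with a pattern reach the displacement `R` in their window. -/
def ReachesAll (r : ℕ) (R : ℝ) (ψ : Fin N → Option (Fin M × Bool))
    (h : ℕ → Equiv.Perm (Fin N)) : Prop :=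
  ∀ i k b, ψ i = some (k, b) → ∃ l, (k : ℕ) * r ≤ l ∧ l ≤ (k + 1) * r ∧
    R ≤ boolSign b * ((h l i : ℝ) - h (k * r) i)

theorem ReachesAll.le_watchedDisplacement (hh : ReachesAll r R ψ h) :
    (Finset.univ.filter fun i => (ψ i).isSome).card * R ≤
      watchedDisplacement r R ψ h (M * r) := by
  classical
  rw [watchedDisplacement, Finset.sum_comm, ← nsmul_eq_mul, ← Finset.sum_const, Finset.sum_filter]
  refine Finset.sum_le_sum fun i _ => ?_
  unfold watchDirection
  cases heq : ψ i with
  | none => simp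
  | some kb =>
    obtain ⟨k, b⟩ := kb
    rw [if_pos (by simp)]
    have := le_sum_watched (n := M * r) (R := R) (x := fun l => (h l i : ℝ)) (k := k) (b := b)
      (Nat.mul_le_mul_right r k.isLt) (hh i k b heq)
    rw [Finset.mul_sum] at this
    refine this.trans_eq (Finset.sum_congr rfl fun j _ => ?_)
    by_cases hw : IsWatched r R (fun l => (h l i : ℝ)) k b j <;> simp [hw]

end StoppedDisplacement

/-! ### Exponential moment of the watched displacement. -/

section ExponentialMoment

variable {α : ℝ} {N M r : ℕ} {R : ℝ} {ψ : Fin N → Option (Fin M × Bool)}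

/-- The direction at step `n` depends only on the path up to `n`, so the new increment is a linear
statistic with coefficients already known. -/
theorem watchedDisplacement_snoc {n : ℕ} (σ : Fin (n + 1) → Equiv.Perm (Fin N))
    (τ : Equiv.Perm (Fin N)) :
    watchedDisplacement r R ψ
        (extendPath (Fin.snoc σ τ : Fin (n + 2) → Equiv.Perm (Fin N))) (n + 1) =
      watchedDisplacement r R ψ (extendPath σ) n +
        ∑ i, watchDirection r R ψ (extendPath σ) n i * ((τ i : ℝ) - σ (Fin.last n) i) := by
  have hext : ∀ l ≤ n, extendPath (Fin.snoc σ τ : Fin (n + 2) → Equiv.Perm (Fin N)) l =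
      extendPath σ l := fun l hl => extendPath_snoc σ τ hl
  rw [← watchedDisplacement_congr hext]
  conv_lhs => rw [watchedDisplacement, Finset.sum_range_succ]
  congr 1
  refine Finset.sum_congr rfl fun i _ => ?_
  rw [watchDirection_congr hext, extendPath_snoc_last, hext n le_rfl, extendPath_last]

/-- Each particle is watched for at most `r` of the `n` steps, so the quadratic terms add up to `N *
r` instead of `N * n`. For `n = M * r` this is the factor `1 / M` that beats the second order cost.
-/
theorem sum_pathWeight_mul_exp_le {q : Equiv.Perm (Fin N) → ℝ} (hq : ∀ σ, 0 ≤ q σ) {l : ℝ}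
    (hl : 0 ≤ l) (hl' : 2 * l ≤ 1) {t : ℝ} (ht : 0 ≤ t) (n : ℕ) :
    ∑ σ : Fin (n + 1) → Equiv.Perm (Fin N),
      (q (σ 0) * ∏ j : Fin n, interchangeKernel α N t (σ j.castSucc) (σ j.succ)) *
        Real.exp (l * watchedDisplacement r R ψ (extendPath σ) n) ≤
      (∑ σ, q σ) * Real.exp (t * ((N : ℝ) ^ α * (n * l + 2 * l ^ 2 * (N * r)))) := by
  have hNα : 0 ≤ (N : ℝ) ^ α := by positivity
  refine (sum_pathWeight_mul_le (p := interchangeKernel α N t) (q := q)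
    (c := fun j => Real.exp (t * ((N : ℝ) ^ α * (l + 2 * l ^ 2 * ∑ i, windowIndicator r ψ j i))))
    (Z := fun n σ => Real.exp (l * watchedDisplacement r R ψ (extendPath σ) n))
    (interchangeKernel_nonneg ht) hq (fun n => (Real.exp_pos _).le) (fun σ => ?_)
    (fun n σ => ?_) n).trans ?_
  · simp [watchedDisplacement]
  · simp only [watchedDisplacement_snoc, mul_add l, Real.exp_add]
    have h := sum_interchangeKernel_mul_exp_le (α := α)
      (fun i => abs_watchDirection_le (r := r) (R := R) (ψ := ψ) (h := extendPath σ) n i)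
      hl hl' ht (σ (Fin.last n))
    have h2 : ∑ i, watchDirection r R ψ (extendPath σ) n i ^ 2 ≤ ∑ i, windowIndicator r ψ n i :=
      Finset.sum_le_sum fun i _ => watchDirection_sq_le n i
    set E := Real.exp (l * watchedDisplacement r R ψ (extendPath σ) n)
    calc ∑ τ, interchangeKernel α N t (σ (Fin.last n)) τ * (E * Real.exp (l * ∑ i,
          watchDirection r R ψ (extendPath σ) n i * ((τ i : ℝ) - σ (Fin.last n) i)))
        = (∑ τ, interchangeKernel α N t (σ (Fin.last n)) τ * Real.exp (l * ∑ i,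
          watchDirection r R ψ (extendPath σ) n i * ((τ i : ℝ) - σ (Fin.last n) i))) * E := by
          rw [Finset.sum_mul]
          exact Finset.sum_congr rfl fun τ _ => by ring
      _ ≤ Real.exp (t * ((N : ℝ) ^ α * (l + 2 * l ^ 2 *
            ∑ i, watchDirection r R ψ (extendPath σ) n i ^ 2))) * E :=
          mul_le_mul_of_nonneg_right h (Real.exp_pos _).le
      _ ≤ _ := by
          refine mul_le_mul_of_nonneg_right ?_ (Real.exp_pos _).le
          gcongr
  · rw [← Real.exp_sum, ← Finset.mul_sum, ← Finset.mul_sum, Finset.sum_add_distrib,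
      Finset.sum_const, Finset.card_range, nsmul_eq_mul, ← Finset.mul_sum, Finset.sum_comm]
    have h : ∑ i, ∑ j ∈ Finset.range n, windowIndicator r ψ j i ≤ (N : ℝ) * r := by
      refine (Finset.sum_le_sum fun i _ => sum_windowIndicator_le n i).trans ?_
      simp
    refine mul_le_mul_of_nonneg_left ?_ (Finset.sum_nonneg fun σ _ => hq σ)
    gcongr

end ExponentialMoment

/-! ### Chernoff bound on grids and passage to dyadic refinements. -/

section GridEvents

variable {T : ℝ}

/-- The `m`-th point of the uniform grid with `n` cells in `[0, T]`. -/
def gridTime (hT : 0 ≤ T) (n m : ℕ) : Set.Icc (0 : ℝ) T :=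
  ⟨(min m n : ℕ) * (T / n), by positivity, by
    rcases Nat.eq_zero_or_pos n with rfl | hn
    · simpa using hT
    · have hn' : (0 : ℝ) < n := by exact_mod_cast hn
      calc ((min m n : ℕ) : ℝ) * (T / n) ≤ n * (T / n) := by
            refine mul_le_mul_of_nonneg_right ?_ (by positivity)
            exact_mod_cast min_le_right m n
        _ = T := by field_simp⟩

theorem gridTime_coe (hT : 0 ≤ T) {n m : ℕ} (h : m ≤ n) :
    (gridTime hT n m : ℝ) = m * (T / n) := by
  simp [gridTime, min_eq_left h]

theorem gridTime_min (hT : 0 ≤ T) (n m : ℕ) : gridTime hT n (min m n) = gridTime hT n m := by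
  simp [gridTime]

theorem gridTime_mul (hT : 0 ≤ T) (n m : ℕ) {c : ℕ} (hc : 0 < c) :
    gridTime hT (n * c) (m * c) = gridTime hT n m := by
  have hc' : (c : ℝ) ≠ 0 := by exact_mod_cast hc.ne'
  refine Subtype.ext ?_
  have hmin : min (m * c) (n * c) = min m n * c := (Nat.mul_min_mul_right m n c).symm ▸ rfl
  simp only [gridTime, hmin]
  push_cast
  rcases Nat.eq_zero_or_pos n with rfl | hn
  · simp
  · have hn' : (n : ℝ) ≠ 0 := by exact_mod_cast hn.ne'
    field_simp

theorem monotone_gridTime (hT : 0 ≤ T) (n : ℕ) : Monotone (gridTime hT n) := by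
  intro m m' h
  refine Subtype.coe_le_coe.1 ?_
  refine mul_le_mul_of_nonneg_right ?_ (by positivity)
  exact_mod_cast min_le_min_right n h

variable {Ω : Type*} [MeasurableSpace Ω] {P : Measure Ω} [IsProbabilityMeasure P] {α : ℝ} {N : ℕ}
  {η : Ω → PermPath T N}

theorem IsInterchangeProcess.sum_initial_le (hη : IsInterchangeProcess P T α N η)
    (t : Set.Icc (0 : ℝ) T) : ∑ σ, P.real {ω | η ω t = σ} ≤ 1 := by
  rw [← measureReal_biUnion_finset (fun σ _ τ _ hστ => Set.disjoint_left.2 fun ω h1 h2 =>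
    hστ (h1.symm.trans h2)) fun σ _ => hη.1 t σ]
  exact measureReal_le_one

/-- The maximal inequality on a grid. -/
theorem IsInterchangeProcess.measure_reachesAll_le (hη : IsInterchangeProcess P T α N η)
    (hT : 0 ≤ T) {M r : ℕ} (hM : 0 < M) (hr : 0 < r) {R : ℝ}
    (ψ : Fin N → Option (Fin M × Bool)) {l : ℝ} (hl : 0 ≤ l) (hl' : 2 * l ≤ 1) :
    P {ω | ReachesAll r R ψ fun m => η ω (gridTime hT (M * r) m)} ≤
      ENNReal.ofReal (Real.exp (-(l * ((Finset.univ.filter fun i => (ψ i).isSome).card * R)) +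
        (N : ℝ) ^ α * (T * l + 2 * l ^ 2 * (T * N / M)))) := by
  classical
  set n := M * r with hn
  set c : ℝ := (Finset.univ.filter fun i => (ψ i).isSome).card * R with hc
  have hM' : (0 : ℝ) < M := by exact_mod_cast hM
  have hr' : (0 : ℝ) < r := by exact_mod_cast hr
  let t : Fin (n + 1) → Set.Icc (0 : ℝ) T := fun j => gridTime hT n j
  have ht : Monotone t := fun i j hij => monotone_gridTime hT n hij
  have hfid := fun σ => hη.2 n t σ ht
  have hstep : ∀ j : Fin n, (t j.succ : ℝ) - t j.castSucc = T / n := by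
    intro j
    simp only [t, Fin.val_succ, Fin.val_castSucc]
    rw [gridTime_coe hT j.isLt, gridTime_coe hT j.isLt.le]
    push_cast
    ring
  simp only [hstep] at hfid
  have hext : ∀ ω, extendPath (fun j : Fin (n + 1) => η ω (t j)) =
      fun m => η ω (gridTime hT n m) := fun ω => funext fun m => by
    simp only [extendPath, t, gridTime_min]
  let bad : Finset (Fin (n + 1) → Equiv.Perm (Fin N)) :=
    Finset.univ.filter fun σ => ReachesAll r R ψ (extendPath σ)
  have hsub : {ω | ReachesAll r R ψ fun m => η ω (gridTime hT n m)} ⊆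
      ⋃ σ ∈ bad, {ω | ∀ j, η ω (t j) = σ j} := by
    intro ω hω
    refine Set.mem_iUnion₂.2 ⟨fun j => η ω (t j), ?_, fun j => rfl⟩
    refine Finset.mem_filter.2 ⟨Finset.mem_univ _, ?_⟩
    rw [hext]
    exact hω
  refine ((measure_mono hsub).trans (measure_biUnion_finset_le _ _)).trans ?_
  simp only [← ofReal_measureReal (measure_ne_top P _)]
  rw [← ENNReal.ofReal_sum_of_nonneg fun σ _ => measureReal_nonneg]
  refine ENNReal.ofReal_le_ofReal ?_
  have hmain := sum_pathWeight_mul_exp_le (α := α) (r := r) (R := R) (ψ := ψ)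
    (q := fun σ => P.real {ω | η ω (t 0) = σ}) (fun σ => measureReal_nonneg) hl hl'
    (t := T / n) (by positivity) n
  have htime : T / n * ((N : ℝ) ^ α * (n * l + 2 * l ^ 2 * (N * r))) =
      (N : ℝ) ^ α * (T * l + 2 * l ^ 2 * (T * N / M)) := by
    rw [hn]
    push_cast
    field_simp
  rw [htime] at hmain
  -- Exponential Chebyshev inequality: on `bad` paths the watched displacement is at least `c`.
  calc ∑ σ ∈ bad, P.real {ω | ∀ j, η ω (t j) = σ j}
      ≤ ∑ σ ∈ bad, Real.exp (-(l * c)) * (P.real {ω | ∀ j, η ω (t j) = σ j} *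
          Real.exp (l * watchedDisplacement r R ψ (extendPath σ) n)) := by
        refine Finset.sum_le_sum fun σ hσ => ?_
        have h1 := ((Finset.mem_filter.1 hσ).2).le_watchedDisplacement
        rw [mul_left_comm, ← Real.exp_add]
        refine le_mul_of_one_le_right measureReal_nonneg (Real.one_le_exp ?_)
        have := mul_le_mul_of_nonneg_left h1 hl
        linarith
    _ ≤ ∑ σ, Real.exp (-(l * c)) * (P.real {ω | ∀ j, η ω (t j) = σ j} *
          Real.exp (l * watchedDisplacement r R ψ (extendPath σ) n)) :=
        Finset.sum_le_sum_of_subset_of_nonneg (Finset.subset_univ _) fun σ _ _ => by positivity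
    _ = Real.exp (-(l * c)) * ∑ σ, P.real {ω | ∀ j, η ω (t j) = σ j} *
          Real.exp (l * watchedDisplacement r R ψ (extendPath σ) n) := by
        rw [Finset.mul_sum]
    _ ≤ Real.exp (-(l * c)) *
          (1 * Real.exp ((N : ℝ) ^ α * (T * l + 2 * l ^ 2 * (T * N / M)))) := by
        refine mul_le_mul_of_nonneg_left ?_ (Real.exp_pos _).le
        simp only [hfid]
        exact hmain.trans (mul_le_mul_of_nonneg_right (hη.sum_initial_le (t 0))
          (Real.exp_pos _).le)
    _ = _ := by rw [one_mul, ← Real.exp_add]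

theorem ReachesAll.refine {hT : 0 ≤ T} {M : ℕ} {R : ℝ} {ψ : Fin N → Option (Fin M × Bool)}
    {η : PermPath T N} {a : ℕ}
    (h : ReachesAll (2 ^ a) R ψ fun m => η (gridTime hT (M * 2 ^ a) m)) :
    ReachesAll (2 ^ (a + 1)) R ψ fun m => η (gridTime hT (M * 2 ^ (a + 1)) m) := by
  intro i k b hi
  obtain ⟨l, h1, h2, h3⟩ := h i k b hi
  refine ⟨l * 2, ?_, ?_, ?_⟩
  · rw [pow_succ, ← mul_assoc]
    exact Nat.mul_le_mul_right 2 h1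
  · rw [pow_succ, ← mul_assoc]
    exact Nat.mul_le_mul_right 2 h2
  · simp only [pow_succ, ← mul_assoc, gridTime_mul hT _ _ two_pos]
    exact h3

/-- The bound on a grid does not involve its mesh, and the dyadic grids are nested, so continuity
from below removes the discretization. -/
theorem IsInterchangeProcess.measure_exists_reachesAll_le (hη : IsInterchangeProcess P T α N η)
    (hT : 0 ≤ T) {M : ℕ} (hM : 0 < M) {R : ℝ}
    (ψ : Fin N → Option (Fin M × Bool)) {l : ℝ} (hl : 0 ≤ l) (hl' : 2 * l ≤ 1) :
    P {ω | ∃ a, ReachesAll (2 ^ a) R ψ fun m => η ω (gridTime hT (M * 2 ^ a) m)} ≤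
      ENNReal.ofReal (Real.exp (-(l * ((Finset.univ.filter fun i => (ψ i).isSome).card * R)) +
        (N : ℝ) ^ α * (T * l + 2 * l ^ 2 * (T * N / M)))) := by
  rw [Set.ofPred_exists, Monotone.measure_iUnion]
  · exact iSup_le fun a => hη.measure_reachesAll_le hT hM (by positivity) ψ hl hl'
  · exact monotone_nat_of_le_succ fun a ω hω => ReachesAll.refine hω

end GridEvents

/-! ### From oscillations in continuous time to grid events, and the union bound. -/

section Discretization

variable {T : ℝ} {N : ℕ}

theorem dist_sitePos (x y : Fin N) : dist (sitePos x) (sitePos y) = |(x : ℝ) - y| / N := by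
  rw [Subtype.dist_eq, Real.dist_eq]
  change |((x : ℝ) + 1) / N - ((y : ℝ) + 1) / N| = _
  rw [← sub_div, add_sub_add_right_eq_sub, abs_div, Nat.abs_cast]

theorem gridTime_mul_coe (hT : 0 ≤ T) {M c k : ℕ} (hc : 0 < c) (hk : k ≤ M) :
    (gridTime hT (M * c) (k * c) : ℝ) = k * (T / M) := by
  rw [gridTime_mul hT M k hc, gridTime_coe hT hk]

/-- A path with a large oscillation has a large displacement, in one of the windows, from the
beginning of the window. -/
theorem exists_window_of_notMem_modulusSet (hT : 0 ≤ T) {M : ℕ} (hM : 0 < M) {ε : ℝ}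
    (hε : 0 < ε) {X : CadlagPath T unitInterval} (hX : X ∉ modulusSet T unitInterval (T / M) ε) :
    0 < T ∧ ∃ k < M, ∃ u : Set.Icc (0 : ℝ) T, k * (T / M) ≤ (u : ℝ) ∧ (u : ℝ) ≤ (k + 1) * (T / M) ∧
      ε / 3 < dist (X u) (X (gridTime hT M k)) := by
  have hM' : (0 : ℝ) < M := by exact_mod_cast hM
  obtain ⟨s, t, hst, hd, hlt⟩ : ∃ s t : Set.Icc (0 : ℝ) T,
      dist s t < T / M ∧ ε < dist (X s) (X t) ∧ s < t := by
    simp only [modulusSet, Set.mem_ofPred_eq, not_forall, not_le] at hX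
    obtain ⟨s, t, hst, hd⟩ := hX
    rcases lt_trichotomy s t with h | h | h
    · exact ⟨s, t, hst, hd, h⟩
    · rw [h, dist_self] at hd
      linarith
    · exact ⟨t, s, by rwa [dist_comm], by rwa [dist_comm], h⟩
  have hlt' : (s : ℝ) < t := hlt
  have hTpos : 0 < T := by linarith [s.2.1, t.2.2]
  refine ⟨hTpos, ?_⟩
  have hw : 0 < T / M := by positivity
  have hMw : (M : ℝ) * (T / M) = T := by field_simp
  rw [dist_comm, Subtype.dist_eq, Real.dist_eq, abs_of_pos (sub_pos.2 hlt')] at hst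
  -- Times closer than `T / M` lie in the same or in adjacent windows. Comparing with the starting
  -- points of the windows uses at most three distances, hence the threshold `ε / 3`.
  by_contra! H
  set k := ⌊(s : ℝ) / (T / M)⌋₊ with hk
  have hs0 : 0 ≤ (s : ℝ) / (T / M) := div_nonneg s.2.1 hw.le
  have hk1 : k * (T / M) ≤ (s : ℝ) := (le_div_iff₀ hw).1 (Nat.floor_le hs0)
  have hk2 : (s : ℝ) < (k + 1) * (T / M) := (div_lt_iff₀ hw).1 (Nat.lt_floor_add_one _)
  have hkM : k < M := by
    have : (k : ℝ) * (T / M) < M * (T / M) := by rw [hMw]; linarith [t.2.2]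
    exact_mod_cast lt_of_mul_lt_mul_right this hw.le
  have h1 := H k hkM s hk1 hk2.le
  rcases le_or_gt (t : ℝ) ((k + 1) * (T / M)) with ht | ht
  · have h2 := H k hkM t (by linarith) ht
    have := dist_triangle_right (X s) (X t) (X (gridTime hT M k))
    linarith
  · have hkM' : k + 1 < M := by
      have : ((k : ℝ) + 1) * (T / M) < M * (T / M) := by rw [hMw]; linarith [t.2.2]
      exact_mod_cast lt_of_mul_lt_mul_right this hw.le
    have hg := gridTime_coe hT hkM'.le
    push_cast at hg
    have h2 := H k hkM (gridTime hT M (k + 1)) (by rw [hg]; nlinarith) hg.le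
    have h3 := H (k + 1) hkM' t (by push_cast; exact ht.le) (by push_cast; nlinarith)
    have h4 := dist_triangle4 (X s) (X (gridTime hT M k)) (X (gridTime hT M (k + 1))) (X t)
    rw [dist_comm (X (gridTime hT M k)), dist_comm (X (gridTime hT M (k + 1))) (X t)] at h4
    linarith

/-- The path is constant for a short time after `u`, and a fine dyadic grid has a point there that
is still in the window. The right end of the window leaves no such room, but is itself a grid point.
-/
theorem PermPath.exists_grid_eq (η : PermPath T N) (hT : 0 < T) {M k : ℕ} (hk : k < M)
    {u : Set.Icc (0 : ℝ) T} (h1 : k * (T / M) ≤ (u : ℝ)) (h2 : (u : ℝ) ≤ (k + 1) * (T / M)) :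
    ∃ a l, k * 2 ^ a ≤ l ∧ l ≤ (k + 1) * 2 ^ a ∧ η (gridTime hT.le (M * 2 ^ a) l) = η u := by
  have hM : 0 < M := by omega
  have hM' : (0 : ℝ) < M := by exact_mod_cast hM
  have hw : 0 < T / M := by positivity
  rcases h2.eq_or_lt with h2 | h2
  · refine ⟨0, k + 1, by omega, by omega, ?_⟩
    congr 1
    refine Subtype.ext ?_
    have := gridTime_mul_coe hT.le (c := 2 ^ 0) (by simp) (show k + 1 ≤ M by omega)
    rw [pow_zero, mul_one, mul_one] at this
    rw [pow_zero, mul_one, this, h2]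
    push_cast
    rfl
  · obtain ⟨d, hd, hη⟩ := Metric.eventually_nhds_iff.1
      (eventually_nhdsWithin_iff.1 (η.eventually_eq_right u))
    have hlim : Tendsto (fun a : ℕ => T / M * (1 / 2 : ℝ) ^ a) atTop (𝓝 0) := by
      simpa using (tendsto_pow_atTop_nhds_zero_of_lt_one (r := (1 / 2 : ℝ))
        (by norm_num) (by norm_num)).const_mul (T / M)
    obtain ⟨a, ha⟩ := (hlim.eventually_lt_const
      (lt_min hd (sub_pos.2 h2))).exists
    set w := T / M * (1 / 2 : ℝ) ^ a with hw'
    have hw0 : 0 < w := by positivity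
    have hw2 : w * 2 ^ a = T / M := by
      rw [hw', mul_assoc, ← mul_pow]
      norm_num
    have hwT : T / ((M * 2 ^ a : ℕ) : ℝ) = w := by
      push_cast
      rw [← div_div, ← hw2]
      field_simp
    set l := ⌈(u : ℝ) / w⌉₊ with hl
    have hl1 : (u : ℝ) ≤ l * w := (div_le_iff₀ hw0).1 (Nat.le_ceil _)
    have hl2 : l * w < u + w := by
      have := Nat.ceil_lt_add_one (div_nonneg u.2.1 hw0.le)
      rw [← hl] at this
      have := mul_lt_mul_of_pos_right this hw0
      rwa [add_mul, one_mul, div_mul_cancel₀ _ hw0.ne'] at this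
    have hlk : l ≤ (k + 1) * 2 ^ a := by
      have : (l : ℝ) * w ≤ ((k + 1) * 2 ^ a : ℕ) * w := by
        push_cast
        rw [mul_assoc, mul_comm ((2 : ℝ) ^ a) w, hw2]
        linarith [ha.trans_le (min_le_right _ _)]
      exact_mod_cast le_of_mul_le_mul_right this hw0
    have hkl : k * 2 ^ a ≤ l := by
      have : ((k * 2 ^ a : ℕ) : ℝ) * w ≤ l * w := by
        push_cast
        rw [mul_assoc, mul_comm ((2 : ℝ) ^ a) w, hw2]
        linarith
      exact_mod_cast le_of_mul_le_mul_right this hw0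
    refine ⟨a, l, hkl, hlk, hη ?_ ?_⟩
    · rw [Subtype.dist_eq, Real.dist_eq,
        gridTime_coe hT.le (hlk.trans (Nat.mul_le_mul_right _ hk)), hwT, abs_of_nonneg] <;>
        linarith [ha.trans_le (min_le_left _ _)]
    · change (u : ℝ) ≤ gridTime hT.le (M * 2 ^ a) l
      rw [gridTime_coe hT.le (hlk.trans (Nat.mul_le_mul_right _ hk)), hwT]
      exact hl1

theorem PermPath.exists_reaches (η : PermPath T N) (hT : 0 ≤ T) {M : ℕ} (hM : 0 < M) {ε : ℝ}
    (hε : 0 < ε) {i : Fin N} (hX : η.trajectory i ∉ modulusSet T unitInterval (T / M) ε) :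
    ∃ (k : Fin M) (b : Bool) (a l : ℕ), (k : ℕ) * 2 ^ a ≤ l ∧ l ≤ (k + 1) * 2 ^ a ∧
      ε * N / 3 ≤ boolSign b * ((η (gridTime hT (M * 2 ^ a) l) i : ℝ) -
        η (gridTime hT (M * 2 ^ a) (k * 2 ^ a)) i) := by
  have hN : (0 : ℝ) < N := by exact_mod_cast (Fin.pos i)
  obtain ⟨hTpos, k, hk, u, h1, h2, h3⟩ := exists_window_of_notMem_modulusSet hT hM hε hX
  obtain ⟨a, l, hl1, hl2, hl3⟩ := η.exists_grid_eq hTpos hk h1 h2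
  have h4 : dist (sitePos (η u i)) (sitePos (η (gridTime hT M k) i)) =
      |(η u i : ℝ) - η (gridTime hT M k) i| / N := dist_sitePos _ _
  change ε / 3 < dist (sitePos (η u i)) (sitePos (η (gridTime hT M k) i)) at h3
  rw [h4, lt_div_iff₀ hN] at h3
  rw [← hl3, ← gridTime_mul hT M k (c := 2 ^ a) (by positivity)] at h3
  rcases le_total 0 ((η (gridTime hT (M * 2 ^ a) l) i : ℝ) -
    η (gridTime hT (M * 2 ^ a) (k * 2 ^ a)) i) with h | h
  · refine ⟨⟨k, hk⟩, true, a, l, hl1, hl2, ?_⟩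
    rw [abs_of_nonneg h] at h3
    simp only [boolSign, if_true, one_mul]
    linarith
  · refine ⟨⟨k, hk⟩, false, a, l, hl1, hl2, ?_⟩
    rw [abs_of_nonpos h] at h3
    simp only [boolSign, Bool.false_eq_true, if_false]
    linarith

open Classical in
theorem PermPath.exists_pattern (η : PermPath T N) (hT : 0 ≤ T) {M : ℕ} (hM : 0 < M) {ε : ℝ}
    (hε : 0 < ε) : ∃ ψ : Fin N → Option (Fin M × Bool),
      (∀ i, (ψ i).isSome ↔ η.trajectory i ∉ modulusSet T unitInterval (T / M) ε) ∧
      ∃ a, ReachesAll (2 ^ a) (ε * N / 3) ψ fun m => η (gridTime hT (M * 2 ^ a) m) := by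
  have h : ∀ i, ∃ (κ : Option (Fin M × Bool)) (a : ℕ),
      (κ.isSome ↔ η.trajectory i ∉ modulusSet T unitInterval (T / M) ε) ∧
      ∀ k b, κ = some (k, b) → ∃ l, (k : ℕ) * 2 ^ a ≤ l ∧ l ≤ (k + 1) * 2 ^ a ∧
        ε * N / 3 ≤ boolSign b * ((η (gridTime hT (M * 2 ^ a) l) i : ℝ) -
          η (gridTime hT (M * 2 ^ a) (k * 2 ^ a)) i) := by
    intro i
    by_cases hi : η.trajectory i ∉ modulusSet T unitInterval (T / M) ε
    · obtain ⟨k, b, a, l, hl⟩ := η.exists_reaches hT hM hε hi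
      refine ⟨some (k, b), a, by simpa using hi, fun k' b' h => ?_⟩
      obtain ⟨rfl, rfl⟩ := Prod.mk.inj (Option.some.inj h)
      exact ⟨l, hl⟩
    · exact ⟨none, 0, by simpa using hi, fun k b h => by simp at h⟩
  choose ψ a hψ hreach using h
  -- Finitely many particles have a common refinement level, as passing to a finer grid keeps all
  -- grid points.
  refine ⟨ψ, hψ, Finset.univ.sup a, fun i k b hi => ?_⟩
  obtain ⟨l, h1, h2, h3⟩ := hreach i k b hi
  have hai : a i ≤ Finset.univ.sup a := Finset.le_sup (Finset.mem_univ i)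
  obtain ⟨c, hc⟩ := Nat.exists_eq_add_of_le hai
  have hpow : (2 : ℕ) ^ Finset.univ.sup a = 2 ^ a i * 2 ^ c := by rw [hc, pow_add]
  refine ⟨l * 2 ^ c, ?_, ?_, ?_⟩
  · rw [hpow, ← mul_assoc]
    exact Nat.mul_le_mul_right _ h1
  · rw [hpow, ← mul_assoc]
    exact Nat.mul_le_mul_right _ h2
  · have hpos : 0 < 2 ^ c := by positivity
    simp only [hpow, ← mul_assoc, gridTime_mul hT _ _ hpos]
    exact h3

variable {Ω : Type*} [MeasurableSpace Ω] {P : Measure Ω} [IsProbabilityMeasure P] {α : ℝ}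
  {η : Ω → PermPath T N}

/-- Union bound over patterns: each particle has `2 * M + 1` options. At least `ε N` particles
covering `ε N / 3` each account for `ε² N² / 3`. -/
theorem IsInterchangeProcess.measure_modulus_le [NeZero N] (hη : IsInterchangeProcess P T α N η)
    (hT : 0 ≤ T) {M : ℕ} (hM : 0 < M) {ε : ℝ} (hε : 0 < ε) {l : ℝ} (hl : 0 ≤ l)
    (hl' : 2 * l ≤ 1) :
    P {ω | ENNReal.ofReal ε < ((η ω).empirical : Measure (CadlagPath T unitInterval))
      (modulusSet T unitInterval (T / M) ε)ᶜ} ≤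
      ENNReal.ofReal ((2 * M + 1) ^ N * Real.exp (-(l * (ε ^ 2 * N ^ 2 / 3)) +
        (N : ℝ) ^ α * (T * l + 2 * l ^ 2 * (T * N / M)))) := by
  classical
  have hN : (0 : ℝ) < N := by exact_mod_cast NeZero.pos N
  let good : Finset (Fin N → Option (Fin M × Bool)) := Finset.univ.filter fun ψ =>
    ε * N ≤ ((Finset.univ.filter fun i => (ψ i).isSome).card : ℝ)
  have hsub : {ω | ENNReal.ofReal ε < ((η ω).empirical : Measure (CadlagPath T unitInterval))
      (modulusSet T unitInterval (T / M) ε)ᶜ} ⊆ ⋃ ψ ∈ good,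
      {ω | ∃ a, ReachesAll (2 ^ a) (ε * N / 3) ψ fun m => η ω (gridTime hT (M * 2 ^ a) m)} := by
    intro ω hω
    obtain ⟨ψ, hψ, hreach⟩ := (η ω).exists_pattern hT hM hε
    refine Set.mem_iUnion₂.2 ⟨ψ, Finset.mem_filter.2 ⟨Finset.mem_univ _, ?_⟩, hreach⟩
    have h1 : ENNReal.ofReal ε < _ := hω
    rw [PermPath.empirical_apply] at h1
    simp only [Set.mem_compl_iff, ← hψ] at h1
    by_contra! hlt
    refine absurd h1 (not_lt.2 ?_)
    rw [← ENNReal.ofReal_natCast N, ← ENNReal.ofReal_natCast, ← ENNReal.ofReal_inv_of_pos hN,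
      ← ENNReal.ofReal_mul (inv_nonneg.2 hN.le)]
    refine ENNReal.ofReal_le_ofReal ?_
    rw [inv_mul_le_iff₀ hN]
    linarith
  set E := Real.exp (-(l * (ε ^ 2 * N ^ 2 / 3)) +
    (N : ℝ) ^ α * (T * l + 2 * l ^ 2 * (T * N / M))) with hE
  calc _ ≤ ∑ ψ ∈ good, P {ω | ∃ a, ReachesAll (2 ^ a) (ε * N / 3) ψ fun m =>
          η ω (gridTime hT (M * 2 ^ a) m)} :=
        (measure_mono hsub).trans (measure_biUnion_finset_le _ _)
    _ ≤ ∑ _ψ ∈ good, ENNReal.ofReal E := by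
        refine Finset.sum_le_sum fun ψ hψ => ?_
        refine (hη.measure_exists_reachesAll_le hT hM ψ hl hl').trans
          (ENNReal.ofReal_le_ofReal (Real.exp_le_exp.2 ?_))
        have h1 := (Finset.mem_filter.1 hψ).2
        have h2 : ε * N * (ε * N / 3) ≤
            ((Finset.univ.filter fun i => (ψ i).isSome).card : ℝ) * (ε * N / 3) :=
          mul_le_mul_of_nonneg_right h1 (by positivity)
        have h3 := mul_le_mul_of_nonneg_left h2 hl
        have h4 : l * (ε * N * (ε * N / 3)) = l * (ε ^ 2 * N ^ 2 / 3) := by ring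
        linarith
    _ ≤ ∑ _ψ : Fin N → Option (Fin M × Bool), ENNReal.ofReal E :=
        Finset.sum_le_sum_of_subset (Finset.subset_univ _)
    _ = _ := by
        rw [Finset.sum_const, Finset.card_univ, nsmul_eq_mul, ENNReal.ofReal_mul (by positivity)]
        congr 1
        rw [← ENNReal.ofReal_natCast]
        congr 1
        simp only [Fintype.card_fun, Fintype.card_option, Fintype.card_prod, Fintype.card_fin,
          Fintype.card_bool]
        push_cast
        ring

end Discretization

/-! ### Choice of the parameters. -/

section Asymptotics

/-- The choice of the parameters in the maximal inequality. -/
theorem exists_window_count_bound {T : ℝ} (hT : 0 ≤ T) {α : ℝ} (hα : α ∈ Set.Ioo (1 : ℝ) 2)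
    {ε : ℝ} (hε : 0 < ε) {a : ℝ} (ha : 0 ≤ a) :
    ∃ M : ℕ, 0 < M ∧ ∃ c : ℝ, 0 ≤ c ∧ ∀ᶠ N : ℕ in atTop,
      2 * (c * (N : ℝ) ^ (1 - α)) ≤ 1 ∧
      (2 * M + 1 : ℝ) ^ N * Real.exp (-(c * (N : ℝ) ^ (1 - α) * (ε ^ 2 * N ^ 2 / 3)) +
        (N : ℝ) ^ α * (T * (c * (N : ℝ) ^ (1 - α)) +
          2 * (c * (N : ℝ) ^ (1 - α)) ^ 2 * (T * N / M))) ≤ Real.exp (-(a * (N : ℝ) ^ (3 - α))) := by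
  obtain ⟨hα1, hα2⟩ := hα
  -- This makes the gain `(a + 2) N ^ (3 - α)`. One of the two spare units absorbs the quadratic
  -- cost, by the choice of `M`; the other absorbs `T c N + N log (2M + 1)`, because `N ^ (2 - α) →
  -- ∞`.
  set c : ℝ := 3 * (a + 2) / ε ^ 2 with hc
  have hc0 : 0 ≤ c := by positivity
  obtain ⟨M, hM⟩ := exists_nat_gt (2 * c ^ 2 * T)
  have hM0 : (0 : ℝ) < M := lt_of_le_of_lt (by positivity) hM
  refine ⟨M, by exact_mod_cast hM0, c, hc0, ?_⟩
  have h1 : Tendsto (fun N : ℕ => (N : ℝ) ^ (2 - α)) atTop atTop :=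
    (tendsto_rpow_atTop (by linarith)).comp tendsto_natCast_atTop_atTop
  have h2 : Tendsto (fun N : ℕ => 2 * (c * (N : ℝ) ^ (1 - α))) atTop (𝓝 0) := by
    have := ((tendsto_rpow_neg_atTop (y := α - 1) (by linarith)).comp
      (tendsto_natCast_atTop_atTop (R := ℝ))).const_mul (2 * c)
    simpa [mul_assoc] using this
  filter_upwards [h1.eventually_ge_atTop (T * c + Real.log (2 * M + 1)),
    h2.eventually_le_const one_pos, eventually_gt_atTop 0] with N hN1 hN2 hN0
  refine ⟨hN2, ?_⟩
  set x : ℝ := (N : ℝ) with hx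
  have hx0 : 0 < x := Nat.cast_pos.2 hN0
  set w := x ^ (1 - α) with hw
  set u := x ^ α with hu
  have huw : u * w = x := by
    rw [hu, hw, ← Real.rpow_add hx0]
    simp
  have hwx : x ^ (2 - α) = w * x := by
    rw [hw, ← Real.rpow_add_one hx0.ne']
    ring_nf
  have hG : x ^ (3 - α) = w * x ^ 2 := by
    rw [hw, ← Real.rpow_natCast x 2, ← Real.rpow_add hx0]
    norm_num
    ring_nf
  have hw0 : 0 < w := Real.rpow_pos_of_pos hx0 _
  rw [hwx] at hN1
  rw [hG, ← Real.rpow_natCast, Real.rpow_def_of_pos (by positivity), ← Real.exp_add,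
    Real.exp_le_exp, ← hx]
  have e1 : c * w * (ε ^ 2 * x ^ 2 / 3) = (a + 2) * (w * x ^ 2) := by
    rw [hc]
    field_simp
  have e2 : u * (T * (c * w) + 2 * (c * w) ^ 2 * (T * x / M)) =
      T * c * x + (2 * c ^ 2 * T / M) * (w * x ^ 2) := by
    calc u * (T * (c * w) + 2 * (c * w) ^ 2 * (T * x / M))
        = T * c * (u * w) + (2 * c ^ 2 * T / M) * (w * x * (u * w)) := by ring
      _ = _ := by
        rw [huw]
        ring
  have e3 : (2 * c ^ 2 * T / M) * (w * x ^ 2) ≤ 1 * (w * x ^ 2) :=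
    mul_le_mul_of_nonneg_right ((div_le_one hM0).2 hM.le) (by positivity)
  have e4 := mul_le_mul_of_nonneg_right hN1 hx0.le
  have e5 : w * x * x = w * x ^ 2 := by ring
  rw [e1, e2]
  nlinarith

/-- With exponentially high probability only a small proportion of the particles have a large
oscillation. -/
theorem exists_modulus_bound {T : ℝ} (hT : 0 ≤ T) {α : ℝ} (hα : α ∈ Set.Ioo (1 : ℝ) 2)
    {Ω : ℕ+ → Type*} [∀ N, MeasurableSpace (Ω N)] {P : ∀ N, Measure (Ω N)}
    [∀ N, IsProbabilityMeasure (P N)] {η : ∀ N : ℕ+, Ω N → PermPath T N}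
    (hη : ∀ N : ℕ+, IsInterchangeProcess (P N) T α N (η N)) {ε : ℝ} (hε : 0 < ε) {a : ℝ}
    (ha : 0 ≤ a) :
    ∃ δ > 0, ∃ N₀ : ℕ, ∀ N : ℕ+, N₀ ≤ N →
      P N {ω | ENNReal.ofReal ε < ((η N ω).empirical : Measure (CadlagPath T unitInterval))
        (modulusSet T unitInterval δ ε)ᶜ} ≤
      ENNReal.ofReal (Real.exp (-(a * (N : ℝ) ^ (3 - α)))) := by
  -- For `T = 0` the scale `T / M` would not be positive, but there is only one time and nothing
  -- oscillates.
  rcases hT.eq_or_lt with rfl | hT'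
  · refine ⟨1, one_pos, 0, fun N _ => ?_⟩
    have huniv : modulusSet 0 unitInterval 1 ε = Set.univ := by
      refine Set.eq_univ_of_forall fun X s t _ => ?_
      have hst : s = t := Subtype.ext ((le_antisymm s.2.2 s.2.1).trans (le_antisymm t.2.2 t.2.1).symm)
      rw [hst, dist_self]
      exact hε.le
    simp [huniv]
  · obtain ⟨M, hM, c, hc, hev⟩ := exists_window_count_bound hT hα hε ha
    obtain ⟨N₀, hN₀⟩ := eventually_atTop.1 hev
    refine ⟨T / M, div_pos hT' (by exact_mod_cast hM), N₀, fun N hN => ?_⟩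
    obtain ⟨h1, h2⟩ := hN₀ N hN
    refine ((hη N).measure_modulus_le hT hM hε (mul_nonneg hc (by positivity)) h1).trans
      (ENNReal.ofReal_le_ofReal h2)

end Asymptotics

/-! ### Small gaps are improbable for fixed `N`. -/

section GapProbability

variable {T : ℝ} {Ω : Type*} [MeasurableSpace Ω] {P : Measure Ω} {N : ℕ} {η : Ω → PermPath T N}

theorem measurableSet_isGapped
    (hη : ∀ (t : Set.Icc (0 : ℝ) T) (σ : Equiv.Perm (Fin N)), MeasurableSet {ω | η ω t = σ})
    (δ : ℝ) : MeasurableSet {ω | IsGapped δ (η ω).toFun} := by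
  obtain ⟨D, hDc, hD⟩ := TopologicalSpace.exists_countable_dense (Set.Icc (0 : ℝ) T)
  let Q : Set (Set.Icc (0 : ℝ) T) := D ∪ {t | (t : ℝ) = T}
  have hQc : Q.Countable := hDc.union (Set.Subsingleton.countable
    fun s hs t ht => Subtype.ext (Eq.trans hs (Eq.symm ht)))
  have heq : ∀ s t, MeasurableSet {ω | η ω s = η ω t} := by
    intro s t
    have : {ω | η ω s = η ω t} = ⋃ σ, {ω | η ω s = σ} ∩ {ω | η ω t = σ} := by
      ext ω
      simp only [Set.mem_ofPred_eq, Set.mem_iUnion, Set.mem_inter_iff]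
      exact ⟨fun h => ⟨η ω t, h, rfl⟩, fun ⟨σ, h1, h2⟩ => h1.trans h2.symm⟩
    rw [this]
    exact MeasurableSet.iUnion fun σ => (hη s σ).inter (hη t σ)
  have hball : ∀ p : Set.Icc (0 : ℝ) T → Ω → Prop, (∀ s ∈ Q, MeasurableSet {ω | p s ω}) →
      MeasurableSet {ω | ∀ s ∈ Q, p s ω} := by
    intro p hp
    simp only [Set.ofPred_forall]
    exact MeasurableSet.biInter hQc hp
  have himp : ∀ (q : Prop) (p : Ω → Prop), MeasurableSet {ω | p ω} →
      MeasurableSet {ω | q → p ω} := fun q p hp => by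
    simp only [Set.ofPred_forall]
    exact MeasurableSet.iInter fun _ => hp
  have hiff := fun ω => isGapped_iff_of_dense (f := (η ω).toFun) (δ := δ)
    (η ω).eventually_eq_right (hD.mono Set.subset_union_left : Dense Q) fun t ht => Or.inr ht
  simp only [hiff]
  refine MeasurableSet.inter ?_ (MeasurableSet.inter ?_ ?_)
  · exact hball _ fun s _ => hball _ fun t _ => hball _ fun u _ =>
      himp _ _ (himp _ _ (himp _ _ ((heq s t).union (heq t u))))
  · exact hball _ fun s _ => hball _ fun u _ => himp _ _ (himp _ _ (heq s u))
  · exact hball _ fun s _ => hball _ fun u _ => himp _ _ (himp _ _ (himp _ _ (heq s u)))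

/-- Every path has some gap, so the events decrease to the empty set. No rate is needed, since the
gap may depend on `N` in any way. -/
theorem exists_measure_not_isGapped_le [IsFiniteMeasure P] (hT : 0 ≤ T)
    (hη : ∀ (t : Set.Icc (0 : ℝ) T) (σ : Equiv.Perm (Fin N)), MeasurableSet {ω | η ω t = σ})
    {c : ℝ≥0∞} (hc : 0 < c) : ∃ δ > 0, P {ω | ¬ IsGapped δ (η ω).toFun} ≤ c := by
  have hlim : Tendsto (fun n : ℕ => P {ω | ¬ IsGapped (1 / ((n : ℝ) + 1)) (η ω).toFun}) atTop
      (𝓝 (P (⋂ n : ℕ, {ω | ¬ IsGapped (1 / ((n : ℝ) + 1)) (η ω).toFun}))) := by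
    refine tendsto_measure_iInter_atTop
      (fun n => (measurableSet_isGapped hη _).compl.nullMeasurableSet) ?_ ⟨0, measure_ne_top P _⟩
    intro n m hnm ω hω h
    exact hω (h.anti (one_div_le_one_div_of_le (by positivity) (by gcongr)))
  have hempty : (⋂ n : ℕ, {ω | ¬ IsGapped (1 / ((n : ℝ) + 1)) (η ω).toFun}) = ∅ := by
    refine Set.eq_empty_of_forall_notMem fun ω hω => ?_
    obtain ⟨δ, hδ, hgap⟩ := (η ω).exists_isGapped hT
    obtain ⟨n, hn⟩ := exists_nat_one_div_lt hδ
    exact Set.mem_iInter.1 hω n (hgap.anti hn.le)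
  rw [hempty, measure_empty] at hlim
  obtain ⟨n, hn⟩ := (hlim.eventually_lt_const hc).exists
  exact ⟨1 / ((n : ℝ) + 1), by positivity, hn.le⟩

end GapProbability

/-! ### The compact sets and their limit points. -/

section TightSets

variable {T : ℝ}

/-- The empirical measures of permutation paths with a given gap `g N` between the jumps of a path
with `N` particles and a given control on the proportion of particles with large oscillations, the
`j`-th control being required only for a large number of particles. -/
def controlledEmpirical (T : ℝ) (g : ℕ+ → ℝ) (δ ε : ℕ → ℝ) (N₀ : ℕ → ℕ) :
    Set (ProbabilityMeasure (CadlagPath T unitInterval)) :=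
  {μ | ∃ (N : ℕ+) (η : PermPath T N), IsGapped (g N) η.toFun ∧
    (∀ j, N₀ j ≤ N → (η.empirical : Measure (CadlagPath T unitInterval))
      (modulusSet T unitInterval (δ j) (ε j))ᶜ ≤ ENNReal.ofReal (ε j)) ∧ μ = η.empirical}

open Classical in
theorem PermPath.empirical_le_of_forall {N : ℕ} [NeZero N] (η : PermPath T N)
    {A B : Set (CadlagPath T unitInterval)} (h : ∀ i, η.trajectory i ∈ A → η.trajectory i ∈ B) :
    (η.empirical : Measure (CadlagPath T unitInterval)) A ≤
      (η.empirical : Measure (CadlagPath T unitInterval)) B := by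
  rw [η.empirical_apply, η.empirical_apply]
  exact mul_le_mul_right (Nat.cast_le.2 (Finset.card_le_card
    (Finset.monotone_filter_right _ fun i _ => h i))) _

variable {g : ℕ+ → ℝ} {δ ε : ℕ → ℝ} {N₀ : ℕ → ℕ}

theorem closure_controlledEmpirical_subset (hg : ∀ N, 0 < g N) (hδ : ∀ j, 0 < δ j)
    (hε : Tendsto ε atTop (𝓝 0)) (hsum : ∑' j, ENNReal.ofReal (ε j) ≠ ⊤) :
    closure (controlledEmpirical T g δ ε N₀) ⊆ permutonSpace T := by
  intro π hπ
  let S : ℕ+ → Set (ProbabilityMeasure (CadlagPath T unitInterval)) := fun N =>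
    {μ | ∃ η : PermPath T N, IsGapped (g N) η.toFun ∧ μ = η.empirical}
  -- If `π` is in no `closure (S N)`, then a neighbourhood of `π` avoids the finitely many `S N`
  -- with `N < n`, for every `n`; hence `N → ∞` along the approximating family.
  by_cases h : ∃ N, π ∈ closure (S N)
  · obtain ⟨N, hN⟩ := h
    obtain ⟨C, hC, hC1, hC2⟩ := exists_isCompact_empirical T N (hg N)
    have hSC : closure (S N) ⊆ C := closure_minimal
      (by rintro μ ⟨η, hη, rfl⟩; exact hC1 η hη) hC.isClosed
    obtain ⟨η, hη⟩ := hC2 π (hSC hN)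
    exact Or.inr ⟨N, η, hη⟩
  · push Not at h
    left
    let ι := {p : Σ N : ℕ+, PermPath T N // IsGapped (g p.1) p.2.toFun ∧
      ∀ j, N₀ j ≤ p.1 → (p.2.empirical : Measure (CadlagPath T unitInterval))
        (modulusSet T unitInterval (δ j) (ε j))ᶜ ≤ ENNReal.ofReal (ε j)}
    let emp : ι → ProbabilityMeasure (CadlagPath T unitInterval) := fun p => p.1.2.empirical
    have hrange : controlledEmpirical T g δ ε N₀ ⊆ Set.range emp := by
      rintro μ ⟨N, η, h1, h2, rfl⟩
      exact ⟨⟨⟨N, η⟩, h1, h2⟩, rfl⟩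
    have hne : (comap emp (𝓝 π)).NeBot :=
      comap_neBot_iff_frequently.2 (mem_closure_iff_frequently.1 (closure_mono hrange hπ))
    have hN : Tendsto (fun p : ι => (p.1.1 : ℕ)) (comap emp (𝓝 π)) atTop := by
      refine tendsto_atTop.2 fun n => ?_
      have h1 : ∀ᶠ μ in 𝓝 π, ∀ N : ℕ+, (N : ℕ) < n → μ ∉ S N := by
        have hfin : {N : ℕ+ | (N : ℕ) < n}.Finite :=
          (Set.finite_lt_nat n).preimage PNat.coe_injective.injOn
        refine (hfin.eventually_all).2 fun N _ => ?_
        filter_upwards [isClosed_closure.isOpen_compl.mem_nhds (h N)] with μ hμ hμS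
        exact hμ (subset_closure hμS)
      filter_upwards [tendsto_comap.eventually h1] with p hp
      by_contra! hlt
      exact hp p.1.1 hlt ⟨p.1.2, p.2.1, rfl⟩
    refine isPermutonProcess_of_tendsto (η := fun p : ι => p.1.2) tendsto_comap hN hδ hε hsum
      fun j => ?_
    filter_upwards [hN.eventually_ge_atTop (N₀ j)] with p hp using p.2.2 j hp

/-- The set of paths used in the proof of tightness. -/
theorem exists_isCompact_controlled (T : ℝ) (hg : ∀ N, 0 < g N) (hδ : ∀ j, 0 < δ j)
    (hε : Tendsto ε atTop (𝓝 0)) (N₀ : ℕ → ℕ) (j₀ : ℕ) :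
    ∃ C : Set (CadlagPath T unitInterval), IsCompact C ∧ ∀ (N : ℕ+) (η : PermPath T N),
      IsGapped (g N) η.toFun → ∀ i, (∀ j, j₀ ≤ j → N₀ j ≤ N →
        η.trajectory i ∈ modulusSet T unitInterval (δ j) (ε j)) → η.trajectory i ∈ C := by
  choose D hD hDη using fun N : ℕ+ => exists_isCompact_trajectory T N (hg N)
  let A : ℕ+ → Set (CadlagPath T unitInterval) := fun N =>
    D N ∩ {X | ∀ j, j₀ ≤ j → N₀ j ≤ N → X ∈ modulusSet T unitInterval (δ j) (ε j)}
  have hA : ∀ N, IsCompact (A N) := by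
    intro N
    refine (hD N).inter_right ?_
    simp only [Set.ofPred_forall]
    exact isClosed_iInter fun j => isClosed_iInter fun _ => isClosed_iInter fun _ =>
      isClosed_modulusSet _ _
  let F : Set (CadlagPath T unitInterval) :=
    {X | ∀ j, j₀ ≤ j → X ∈ modulusSet T unitInterval (δ j) (ε j)}
  refine ⟨F ∪ ⋃ N, A N, ?_, fun N η hη i h =>
    Or.inr (Set.mem_iUnion.2 ⟨N, hDη N η hη i, h⟩)⟩
  refine isCompact_iff_ultrafilter_le_nhds'.2 fun U hU => ?_
  -- Otherwise the ultrafilter avoids the finitely many `A N` with `N < N₀ j`, so every modulus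
  -- condition from `j₀` on holds along it and Arzelà–Ascoli applies.
  by_cases h : ∃ N, A N ∈ U
  · obtain ⟨N, hN⟩ := h
    obtain ⟨X, hX, hXU⟩ := (hA N).ultrafilter_le_nhds' U hN
    exact ⟨X, Or.inr (Set.mem_iUnion.2 ⟨N, hX⟩), hXU⟩
  · push Not at h
    have hmem : ∀ j, j₀ ≤ j → modulusSet T unitInterval (δ j) (ε j) ∈ U := by
      intro j hj
      have hfin : {N : ℕ+ | (N : ℕ) < N₀ j}.Finite :=
        (Set.finite_lt_nat _).preimage PNat.coe_injective.injOn
      have h1 : ∀ᶠ X in (U : Filter (CadlagPath T unitInterval)),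
          ∀ N : ℕ+, (N : ℕ) < N₀ j → X ∉ A N :=
        (hfin.eventually_all).2 fun N _ => Ultrafilter.compl_mem_iff_notMem.2 (h N)
      filter_upwards [h1, hU] with X hX1 hX2
      rcases hX2 with hX2 | hX2
      · exact hX2 j hj
      · obtain ⟨N, hN⟩ := Set.mem_iUnion.1 hX2
        exact hN.2 j hj (not_lt.1 fun hlt => hX1 N hlt hN)
    obtain ⟨X, hX, hXU⟩ := CadlagPath.exists_ultrafilter_le_nhds (p := fun j => j₀ ≤ j) hδ
      (fun r hr => ((eventually_ge_atTop j₀).and (hε.eventually_lt_const hr)).exists) U hmem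
    exact ⟨X, Or.inl hX, hXU⟩

/-- By Prokhorov tightness suffices. Particles violating some active control with `j ≥ j₀` have
total proportion at most the tail of the series; all other trajectories lie in one compact set. -/
theorem isCompact_closure_controlledEmpirical (hg : ∀ N, 0 < g N) (hδ : ∀ j, 0 < δ j)
    (hε : Tendsto ε atTop (𝓝 0)) (hsum : ∑' j, ENNReal.ofReal (ε j) ≠ ⊤) :
    IsCompact (closure (controlledEmpirical T g δ ε N₀)) := by
  refine isCompact_closure_of_isTightMeasureSet
    (isTightMeasureSet_iff_exists_isCompact_measure_compl_le.2 fun r hr => ?_)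
  obtain ⟨j₀, hj₀⟩ := ((ENNReal.tendsto_sum_nat_add _ hsum).eventually_lt_const hr).exists
  obtain ⟨C, hC, hCη⟩ := exists_isCompact_controlled T hg hδ hε N₀ j₀
  refine ⟨C, hC, ?_⟩
  rintro _ ⟨μ, ⟨N, η, hη, hμ, rfl⟩, rfl⟩
  let B : ℕ → Set (CadlagPath T unitInterval) := fun j =>
    {X | N₀ (j + j₀) ≤ N ∧ X ∈ (modulusSet T unitInterval (δ (j + j₀)) (ε (j + j₀)))ᶜ}
  have hB : ∀ j, (η.empirical : Measure (CadlagPath T unitInterval)) (B j) ≤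
      ENNReal.ofReal (ε (j + j₀)) := by
    intro j
    by_cases hj : N₀ (j + j₀) ≤ N
    · exact (measure_mono fun X hX => hX.2).trans (hμ _ hj)
    · have : B j = ∅ := Set.eq_empty_of_forall_notMem fun X hX => hj hX.1
      simp [this]
  calc (η.empirical : Measure (CadlagPath T unitInterval)) Cᶜ
      ≤ (η.empirical : Measure (CadlagPath T unitInterval)) (⋃ j, B j) := by
        refine η.empirical_le_of_forall fun i hi => ?_
        by_contra hiB
        refine hi (hCη N η hη i fun j hj hN => ?_)
        by_contra hX
        refine hiB (Set.mem_iUnion.2 ⟨j - j₀, ?_⟩)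
        simp only [B, Nat.sub_add_cancel hj]
        exact ⟨hN, hX⟩
    _ ≤ ∑' j, (η.empirical : Measure (CadlagPath T unitInterval)) (B j) := measure_iUnion_le _
    _ ≤ ∑' j, ENNReal.ofReal (ε (j + j₀)) := ENNReal.tsum_le_tsum hB
    _ ≤ r := hj₀.le

end TightSets

/-! ### Assembly of the estimates. -/

section ExponentialTightness

theorem tsum_ofReal_geometric_two (c : ℝ) (hc : 0 ≤ c) :
    ∑' j : ℕ, ENNReal.ofReal (c * (1 / 2) ^ j) = ENNReal.ofReal (c * 2) := by
  rw [← ENNReal.ofReal_tsum_of_nonneg (fun j => by positivity)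
    (summable_geometric_two.mul_left c), tsum_mul_left, tsum_geometric_two]

theorem exp_neg_add_le {m x : ℝ} (hx : 1 ≤ x) (j : ℕ) :
    Real.exp (-((m + (j + 2)) * x)) ≤ Real.exp (-(m * x)) / 4 * (1 / 2) ^ j := by
  have h1 : Real.exp (-(((j : ℝ) + 2) * x)) ≤ (1 / 2) ^ (j + 2) := by
    have h2 : Real.exp (-1) ≤ 1 / 2 := by
      rw [Real.exp_neg, one_div]
      exact inv_anti₀ two_pos (by linarith [Real.add_one_le_exp (1 : ℝ)])
    calc Real.exp (-(((j : ℝ) + 2) * x)) ≤ Real.exp (((j + 2 : ℕ) : ℝ) * (-1)) := by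
          refine Real.exp_le_exp.2 ?_
          push_cast
          nlinarith [(Nat.cast_nonneg j : (0 : ℝ) ≤ j)]
      _ = Real.exp (-1) ^ (j + 2) := Real.exp_nat_mul _ _
      _ ≤ _ := pow_le_pow_left₀ (Real.exp_pos _).le h2 _
  calc Real.exp (-((m + (j + 2)) * x)) =
        Real.exp (-(m * x)) * Real.exp (-(((j : ℝ) + 2) * x)) := by
        rw [← Real.exp_add]
        ring_nf
    _ ≤ Real.exp (-(m * x)) * (1 / 2) ^ (j + 2) := by gcongr
    _ = _ := by ring

theorem exists_compact_measure_notMem_le {T : ℝ} (hT : 0 ≤ T) {α : ℝ}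
    (hα : α ∈ Set.Ioo (1 : ℝ) 2) {Ω : ℕ+ → Type*} [∀ N, MeasurableSpace (Ω N)]
    {P : ∀ N, Measure (Ω N)} [∀ N, IsProbabilityMeasure (P N)]
    {η : ∀ N : ℕ+, Ω N → PermPath T N}
    (hη : ∀ N : ℕ+, IsInterchangeProcess (P N) T α N (η N)) (m : ℕ) :
    ∃ K : Set (ProbabilityMeasure (CadlagPath T unitInterval)), IsCompact K ∧
      K ⊆ permutonSpace T ∧ ∀ N : ℕ+, P N {ω | (η N ω).empirical ∉ K} ≤
        ENNReal.ofReal (Real.exp (-(m * (N : ℝ) ^ (3 - α)))) := by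
  let ε : ℕ → ℝ := fun j => (1 / 2) ^ j
  have hε0 : ∀ j, 0 < ε j := fun j => by positivity
  have hε : Tendsto ε atTop (𝓝 0) :=
    tendsto_pow_atTop_nhds_zero_of_lt_one (by norm_num) (by norm_num)
  have hsum : ∑' j, ENNReal.ofReal (ε j) ≠ ⊤ := by
    have := tsum_ofReal_geometric_two 1 zero_le_one
    simp only [one_mul] at this
    simp only [ε, this]
    exact ENNReal.ofReal_ne_top
  -- The rate `m + (j + 2)` makes the failures summable over `j`, with sum at most `E / 2`; the gap
  -- failure takes the other half. Controls with `N < N₀ j` are not imposed, so the final bound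
  -- holds for every `N`.
  choose δ hδ N₀ hN₀ using fun j : ℕ => exists_modulus_bound hT hα hη (hε0 j)
    (a := (m : ℝ) + (j + 2)) (by positivity)
  choose g hg hgP using fun N : ℕ+ => exists_measure_not_isGapped_le (P := P N) hT (hη N).1
    (c := ENNReal.ofReal (Real.exp (-(m * (N : ℝ) ^ (3 - α))) / 2))
    (ENNReal.ofReal_pos.2 (by positivity))
  refine ⟨closure (controlledEmpirical T g δ ε N₀),
    isCompact_closure_controlledEmpirical hg hδ hε hsum,
    closure_controlledEmpirical_subset hg hδ hε hsum, fun N => ?_⟩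
  set x : ℝ := (N : ℝ) ^ (3 - α) with hx
  have hx1 : 1 ≤ x := Real.one_le_rpow (by exact_mod_cast N.pos) (by linarith [hα.2])
  set E := Real.exp (-(m * x)) with hE
  have hE0 : 0 < E := Real.exp_pos _
  let B : ℕ → Set (Ω N) := fun j => {ω | N₀ j ≤ N ∧ ENNReal.ofReal (ε j) <
    ((η N ω).empirical : Measure (CadlagPath T unitInterval))
      (modulusSet T unitInterval (δ j) (ε j))ᶜ}
  have hB : ∀ j, P N (B j) ≤ ENNReal.ofReal (E / 4 * (1 / 2) ^ j) := by
    intro j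
    by_cases hj : N₀ j ≤ N
    · exact (measure_mono fun ω hω => hω.2).trans ((hN₀ j N hj).trans
        (ENNReal.ofReal_le_ofReal (exp_neg_add_le hx1 j)))
    · have : B j = ∅ := Set.eq_empty_of_forall_notMem fun X hX => hj hX.1
      simp [this]
  have hsub : {ω | (η N ω).empirical ∉ closure (controlledEmpirical T g δ ε N₀)} ⊆
      {ω | ¬ IsGapped (g N) (η N ω).toFun} ∪ ⋃ j, B j := by
    intro ω hω
    by_contra hω'
    simp only [Set.mem_union, Set.mem_iUnion, Set.mem_ofPred_eq, not_or, not_not, not_exists,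
      B, not_and, not_lt] at hω'
    exact hω (subset_closure ⟨N, η N ω, hω'.1, hω'.2, rfl⟩)
  calc P N {ω | (η N ω).empirical ∉ closure (controlledEmpirical T g δ ε N₀)}
      ≤ P N {ω | ¬ IsGapped (g N) (η N ω).toFun} + P N (⋃ j, B j) :=
        (measure_mono hsub).trans (measure_union_le _ _)
    _ ≤ ENNReal.ofReal (E / 2) + ∑' j, ENNReal.ofReal (E / 4 * (1 / 2) ^ j) :=
        add_le_add (hgP N) ((measure_iUnion_le _).trans (ENNReal.tsum_le_tsum hB))
    _ = ENNReal.ofReal E := by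
        rw [tsum_ofReal_geometric_two _ (by positivity), ← ENNReal.ofReal_add (by positivity)
          (by positivity)]
        congr 1
        ring

theorem rpow_neg_mul_log_le {x y : ℝ} (hx : 0 < x) {m : ℕ} {p : ℝ≥0∞}
    (hp : p ≤ ENNReal.ofReal (Real.exp (-(m * x ^ y)))) :
    ((x ^ (-y) : ℝ) : EReal) * ENNReal.log p ≤ -(m : EReal) := by
  have hlog : ENNReal.log p ≤ ((-(m * x ^ y) : ℝ) : EReal) := by
    refine (ENNReal.log_monotone hp).trans_eq ?_
    rw [ENNReal.log_ofReal_of_pos (Real.exp_pos _), Real.log_exp]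
  calc ((x ^ (-y) : ℝ) : EReal) * ENNReal.log p
      ≤ ((x ^ (-y) : ℝ) : EReal) * ((-(m * x ^ y) : ℝ) : EReal) :=
        mul_le_mul_of_nonneg_left hlog (by exact_mod_cast Real.rpow_nonneg hx.le _)
    _ = ((-(m : ℝ) : ℝ) : EReal) := by
        rw [← EReal.coe_mul]
        congr 1
        rw [Real.rpow_neg hx.le]
        have := (Real.rpow_pos_of_pos hx y).ne'
        field_simp
    _ = -(m : EReal) := by simp

end ExponentialTightness

end

theorem mainTheorem8 (T : ℝ) (hT : 0 ≤ T) (α : ℝ) (hα : α ∈ Set.Ioo (1 : ℝ) 2)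
    (Ω : ℕ+ → Type*) [∀ N, MeasurableSpace (Ω N)]
    (P : ∀ N, Measure (Ω N)) [∀ N, IsProbabilityMeasure (P N)]
    (η : ∀ N : ℕ+, Ω N → PermPath T N)
    (hη : ∀ N : ℕ+, IsInterchangeProcess (P N) T α N (η N)) :
    ∃ K : ℕ → Set (ProbabilityMeasure (CadlagPath T unitInterval)),
      ∀ m : ℕ, IsCompact (K m) ∧ K m ⊆ permutonSpace T ∧
        limsup (fun N : ℕ+ => (((N : ℝ) ^ (-(3 - α)) : ℝ) : EReal) *
          ENNReal.log (P N {ω | (η N ω).empirical ∉ K m})) atTop ≤ -(m : EReal) := by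
  choose K hK hKP hKη using exists_compact_measure_notMem_le hT hα hη
  refine ⟨K, fun m => ⟨hK m, hKP m, ?_⟩⟩
  exact limsup_le_of_le (h := Eventually.of_forall fun N =>
    rpow_neg_mul_log_le (by exact_mod_cast N.pos) (hKη m N))
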